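/- Let $\mathbf c:\mathbb R\to\mathbb R^3$ be a $C^\infty$ closed Frenet curve of length $L>0$, that is, an $L$-periodic unit-speed curve that is simple (injective on $[0,L)$) and has curvature $k>0$ everywhere, with Frenet frame $t=\mathbf c'$, $n=t'/k$, $b=t\wedge n$ and torsion $\tau=\langle n',b\rangle$. Suppose that $\tau$ is not identically zero and that $\int_0^L\tau(s)\,ds=2m\pi$ for some $m\in\mathbb Z$. Then there is a germ along $\mathbf c$ of an oriented embedded surface of class $C^\infty$ (hence of class $C^r$ for every $r\ge 4$) that contains $\mathbf c$ and has $\mathbf c$ as a hyperbolic principal cycle. Here this means: there are $\delta>0$ and a map $\alpha(s,v)$, $L$-periodic in $s$, that restricts to a $C^\infty$ immersion on $\mathbb R\times(-\delta,\delta)$ inducing an embedding of $(\mathbb R/L\mathbb Z)\times(-\delta,\delta)$ into $\mathbb R^3$, such that $\alpha(s,0)=\mathbf c(s)$ for all $s$; the surface has no umbilic point on $\mathbf c$; $\mathbf c$ is a leaf of one of the two principal foliations (along whose leaves the normal curvature is minimal, respectively maximal, among all tangent directions); and the Poincaré first return map $\pi$ of this foliation along $\mathbf c$, on the section $\{s=0\}$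 with coordinate $v$, satisfies $\pi'(0)\neq 1$. Moreover, the surface can be taken in the following explicit form. For a function $\theta$ with $\theta'=-\tau$ and for $\varepsilon\in\mathbb R$ put $$A_\varepsilon=(1-\sin\theta)\,k+\varepsilon\,(k\sin\theta)',\qquad \Lambda(\varepsilon)=\int_0^L\frac{A_\varepsilon'(s)}{A_\varepsilon(s)+k(s)\sin\theta(s)}\,ds ,$$ $$\alpha_\varepsilon(s,v)=\mathbf c(s)+v\,\big[\cos\theta(s)\, n(s)+\sin\theta(s)\, b(s)\big]+\tfrac12A_\varepsilon(s)\,v^2\,\big[\cos\theta(s)\, b(s)-\sin\theta(s)\, n(s)\big].$$ Then $\theta$ can be chosen so that: if $\Lambda(0)\ne0$, then $\alpha_0$ defines such a germ; and if $\Lambda(0)=0$, then for every sufficiently small $\varepsilon\neq0$ one has $\Lambda(\varepsilon)\ne0$ and $\alpha_\varepsilon$ defines such a germ. -/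

import Mathlib

open Set Filter Topology
open scoped ContDiff

noncomputable section

/-- Euclidean three-space. -/
abbrev E3 : Type := EuclideanSpace ℝ (Fin 3)

/-- The vector product of `ℝ³`. -/
def cross (x y : E3) : E3 := WithLp.toLp 2 (crossProduct (WithLp.ofLp x) (WithLp.ofLp y))

/-! ### Closed Frenet curves, parametrized by arc length -/

/-- The curvature `k = |c''|` of a unit speed curve. -/
def curvature (c : ℝ → E3) (s : ℝ) : ℝ := ‖deriv (deriv c) s‖

/-- The principal normal `n = t' / k`, where `t = c'`. -/
def principalNormal (c : ℝ → E3) (s : ℝ) : E3 := (curvature c s)⁻¹ • deriv (deriv c) s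

/-- The binormal `b = t ∧ n`. -/
def binormal (c : ℝ → E3) (s : ℝ) : E3 := cross (deriv c s) (principalNormal c s)

/-- The torsion, i.e. the coefficient `τ` in the Frenet equation `n' = -k t + τ b`. -/
def torsion (c : ℝ → E3) (s : ℝ) : ℝ := inner ℝ (deriv (principalNormal c) s) (binormal c s)

/-- A smooth simple closed regular curve of length `L` with positive curvature, parametrized by
arc length and extended `L`-periodically to the line. -/
structure IsClosedFrenetCurve (c : ℝ → E3) (L : ℝ) : Prop where
  length_pos : 0 < L
  smooth : ContDiff ℝ ∞ c
  periodic : Function.Periodic c L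
  simple : InjOn c (Ico 0 L)
  unit_speed : ∀ s, ‖deriv c s‖ = 1
  curvature_pos : ∀ s, 0 < curvature c s

/-! ### Fundamental forms of a parametrized surface `α (u, v)` -/

/-- The partial derivative `α_u`. -/
def partialU (α : ℝ × ℝ → E3) (p : ℝ × ℝ) : E3 := fderiv ℝ α p (1, 0)

/-- The partial derivative `α_v`. -/
def partialV (α : ℝ × ℝ → E3) (p : ℝ × ℝ) : E3 := fderiv ℝ α p (0, 1)

/-- The positive unit normal `N = (α_u ∧ α_v) / |α_u ∧ α_v|`; the orientation of the surface is the
one of the parameters `(u, v)`. -/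
def unitNormal (α : ℝ × ℝ → E3) (p : ℝ × ℝ) : E3 :=
  ‖cross (partialU α p) (partialV α p)‖⁻¹ • cross (partialU α p) (partialV α p)

/-- `E` (first fundamental form). -/
def coeffE (α : ℝ × ℝ → E3) (p : ℝ × ℝ) : ℝ := inner ℝ (partialU α p) (partialU α p)

/-- `F` (first fundamental form). -/
def coeffF (α : ℝ × ℝ → E3) (p : ℝ × ℝ) : ℝ := inner ℝ (partialU α p) (partialV α p)

/-- `G` (first fundamental form). -/
def coeffG (α : ℝ × ℝ → E3) (p : ℝ × ℝ) : ℝ := inner ℝ (partialV α p) (partialV α p)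

/-- `e = ⟨N, α_uu⟩ = det[α_u, α_v, α_uu] / √(EG - F²)` (second fundamental form). -/
def coeffe (α : ℝ × ℝ → E3) (p : ℝ × ℝ) : ℝ :=
  inner ℝ (unitNormal α p) (partialU (partialU α) p)

/-- `f = ⟨N, α_uv⟩ = det[α_u, α_v, α_uv] / √(EG - F²)` (second fundamental form). -/
def coefff (α : ℝ × ℝ → E3) (p : ℝ × ℝ) : ℝ :=
  inner ℝ (unitNormal α p) (partialV (partialU α) p)

/-- `g = ⟨N, α_vv⟩ = det[α_u, α_v, α_vv] / √(EG - F²)` (second fundamental form). -/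
def coeffg (α : ℝ × ℝ → E3) (p : ℝ × ℝ) : ℝ :=
  inner ℝ (unitNormal α p) (partialV (partialV α) p)

/-- The normal curvature `(e du² + 2 f du dv + g dv²) / (E du² + 2 F du dv + G dv²)` in the
direction `w = (du, dv)`. -/
def normalCurvature (α : ℝ × ℝ → E3) (p w : ℝ × ℝ) : ℝ :=
  (coeffe α p * w.1 ^ 2 + 2 * coefff α p * w.1 * w.2 + coeffg α p * w.2 ^ 2) /
    (coeffE α p * w.1 ^ 2 + 2 * coeffF α p * w.1 * w.2 + coeffG α p * w.2 ^ 2)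

/-! ### Principal configuration -/

/-- The equation of principal directions
`(Fg - Gf) dv² + (Eg - Ge) du dv + (Ef - Fe) du² = 0` for `w = (du, dv)`. -/
def PrincipalEquation (α : ℝ × ℝ → E3) (p w : ℝ × ℝ) : Prop :=
  (coeffF α p * coeffg α p - coeffG α p * coefff α p) * w.2 ^ 2 +
    (coeffE α p * coeffg α p - coeffG α p * coeffe α p) * (w.1 * w.2) +
    (coeffE α p * coefff α p - coeffF α p * coeffe α p) * w.1 ^ 2 = 0

/-- Umbilic points: the three coefficients of the equation of principal directions vanish. -/
def IsUmbilic (α : ℝ × ℝ → E3) (p : ℝ × ℝ) : Prop :=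
  coeffF α p * coeffg α p - coeffG α p * coefff α p = 0 ∧
    coeffE α p * coeffg α p - coeffG α p * coeffe α p = 0 ∧
    coeffE α p * coefff α p - coeffF α p * coeffe α p = 0

/-- The line field of the minimal foliation: the normal curvature attains its minimum along `w`. -/
def MinimalDirection (α : ℝ × ℝ → E3) (p w : ℝ × ℝ) : Prop :=
  ∀ w' : ℝ × ℝ, w' ≠ 0 → normalCurvature α p w ≤ normalCurvature α p w'

/-- The line field of the maximal foliation: the normal curvature attains its maximum along `w`. -/
def MaximalDirection (α : ℝ × ℝ → E3) (p w : ℝ × ℝ) : Prop :=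
  ∀ w' : ℝ × ℝ, w' ≠ 0 → normalCurvature α p w' ≤ normalCurvature α p w

/-- On the interval `J`, `γ` is a principal curvature line of `α`, contained in the foliation with
direction field `D` (below, the minimal or the maximal one): a differentiable curve with nonvanishing
velocity, without umbilic points, solving the equation of principal directions. -/
def IsPrincipalLine (α : ℝ × ℝ → E3) (D : ℝ × ℝ → ℝ × ℝ → Prop) (J : Set ℝ)
    (γ : ℝ → ℝ × ℝ) : Prop :=
  ∀ t ∈ J, ¬ IsUmbilic α (γ t) ∧ ∃ w : ℝ × ℝ, w ≠ 0 ∧ HasDerivWithinAt γ w J t ∧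
    PrincipalEquation α (γ t) w ∧ D (γ t) w

/-! ### Annuli around a closed curve and hyperbolicity -/

/-- `α (s, v)`, `|v| < δ`, is a smooth immersion which is `L`-periodic in `s` and induces a
topological embedding of the annulus `(ℝ / Lℤ) × (-δ, δ)`: an oriented embedded surface, an annulus
around the closed curve `v = 0`. -/
structure IsEmbeddedAnnulus (α : ℝ × ℝ → E3) (L δ : ℝ) : Prop where
  smooth : ContDiffOn ℝ ∞ α (univ ×ˢ Ioo (-δ) δ)
  immersion : ∀ p ∈ (univ : Set ℝ) ×ˢ Ioo (-δ) δ,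
    LinearIndependent ℝ ![partialU α p, partialV α p]
  embedding : ∃ Φ : AddCircle L × Ioo (-δ) δ → E3, IsEmbedding Φ ∧
    ∀ (s : ℝ) (v : Ioo (-δ) δ), Φ ((s : AddCircle L), v) = α (s, (v : ℝ))

/-- `π` is, near `0`, the Poincaré first return map of the closed curve `v = 0` on the transversal
section `s = 0` of the annulus, for the foliation with direction field `D`. In the
universal cover `ℝ × (-δ, δ)` of the annulus, the leaf through `(0, x)` runs, without meeting the
section in between, to the next lift `s = L` of the section, which it meets at `(L, π x)`. -/
def IsReturnMap (α : ℝ × ℝ → E3) (D : ℝ × ℝ → ℝ × ℝ → Prop) (L δ : ℝ) (π : ℝ → ℝ) : Prop :=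
  ∃ η > 0, ∀ x : ℝ, |x| < η → ∃ (a : ℝ) (γ : ℝ → ℝ × ℝ), 0 < a ∧
    IsPrincipalLine α D (Icc 0 a) γ ∧ (∀ t ∈ Icc 0 a, |(γ t).2| < δ) ∧
    γ 0 = (0, x) ∧ γ a = (L, π x) ∧ ∀ t ∈ Ioo 0 a, 0 < (γ t).1 ∧ (γ t).1 < L

/-- The closed curve `v = 0` is a leaf of the principal foliation with direction field `D`, and its
return map has at the fixed point a derivative different from one. -/
def IsHyperbolicCycleOf (α : ℝ × ℝ → E3) (D : ℝ × ℝ → ℝ × ℝ → Prop) (L δ : ℝ) : Prop :=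
  IsPrincipalLine α D univ (fun s => (s, 0)) ∧
    ∃ (π : ℝ → ℝ) (d : ℝ), IsReturnMap α D L δ π ∧ HasDerivAt π d 0 ∧ d ≠ 1

/-- The closed curve `v = 0` is a hyperbolic principal cycle, of one of the two foliations. -/
def IsHyperbolicPrincipalCycle (α : ℝ × ℝ → E3) (L δ : ℝ) : Prop :=
  IsHyperbolicCycleOf α (MinimalDirection α) L δ ∨ IsHyperbolicCycleOf α (MaximalDirection α) L δ

/-- The germ of `α` along `v = 0` is the germ of an oriented smooth embedded surface which contains
the closed curve `c` (as `v = 0`) and has it as a hyperbolic principal cycle. -/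
def IsGermWithHyperbolicCycle (c : ℝ → E3) (L : ℝ) (α : ℝ × ℝ → E3) : Prop :=
  ∃ δ > 0, IsEmbeddedAnnulus α L δ ∧ (∀ s, α (s, 0) = c s) ∧ IsHyperbolicPrincipalCycle α L δ

/-! ### The explicit surfaces -/

/-- The surface
`c + v (cos θ n + sin θ b) + (A v² / 2) (cos θ b - sin θ n)`. -/
def stripSurface (c : ℝ → E3) (θ A : ℝ → ℝ) (p : ℝ × ℝ) : E3 :=
  c p.1 +
    p.2 • (Real.cos (θ p.1) • principalNormal c p.1 + Real.sin (θ p.1) • binormal c p.1) +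
    (A p.1 * p.2 ^ 2 / 2) •
      (Real.cos (θ p.1) • binormal c p.1 - Real.sin (θ p.1) • principalNormal c p.1)

/-- The function `A_ε = (1 - sin θ) k + ε (k sin θ)'`. -/
def coeffA (c : ℝ → E3) (θ : ℝ → ℝ) (ε s : ℝ) : ℝ :=
  (1 - Real.sin (θ s)) * curvature c s + ε * deriv (fun x => curvature c x * Real.sin (θ x)) s

/-- The characteristic exponent `∫₀ᴸ A' / (A + k sin θ) ds`. -/
def charExponent (c : ℝ → E3) (L : ℝ) (θ A : ℝ → ℝ) : ℝ :=
  ∫ s in (0 : ℝ)..L, deriv A s / (A s + curvature c s * Real.sin (θ s))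

end

/-!
Write `κ = k sin θ`. Because `θ' = -τ`, the frame `T = c'`, `U = cos θ n + sin θ b`,
`V = cos θ b - sin θ n` is parallel in the normal bundle, and it closes up since the total torsion
is a multiple of `2π`. In this frame the surface `α = c + v U + (A v² / 2) V` has fundamental forms
which are polynomial in `v` (`IsParallelFrame.exists_hasForms`); along `v = 0` the first one is the
identity and the second one is `diag (-κ, A)`. With `A + κ > 0` there is no umbilic point on the
curve, and the curve is a leaf of the minimal foliation. The slope `P (s, v)` of that
foliation is the smooth root of the equation of principal directions `L P² + M P + N = 0`
(`HasForms.principal_direction`), and `∂P/∂v = -A' / (A + κ)` on `v = 0`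
(`HasForms.hasDerivAt_principalSlope`).

The leaves are thus graphs of solutions of `v' = P (s, v)`, and the return map is the transition map
from `s = 0` to `s = L`. Its derivative at the fixed point is
`exp (-∫ A' / (A + κ))` (`exists_transitionMap`: variation of constants, after a Lipschitz extension
of the equation which makes Picard–Lindelöf apply on the whole of `[0, L]`). So the curve is a
hyperbolic cycle exactly if the characteristic exponent does not vanish. That a thin ribbon is
embedded follows from the simplicity of the curve and the local injectivity of immersions, by
compactness (`exists_embedding_annulus`).

For `A = A_ε` one has `A_ε + κ = k + ε κ'`, and the exponent is `-∫ κ' / (k + ε κ')`. If it vanishes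
at `ε = 0`, it equals `ε ∫ κ'² / (k (k + ε κ'))`, which is nonzero for small `ε ≠ 0` provided that `κ`
is not constant. Since `τ` does not vanish identically, this holds for one of the angles `θ` and
`θ + π / 2`.
-/

/-! ### The vector product and adapted frames -/

lemma cross_add_left (x y z : E3) : cross (x + y) z = cross x z + cross y z := by
  simp [cross]

lemma cross_add_right (x y z : E3) : cross x (y + z) = cross x y + cross x z := by
  simp [cross]

lemma cross_smul_left (a : ℝ) (x y : E3) : cross (a • x) y = a • cross x y := by
  simp [cross]

lemma cross_smul_right (a : ℝ) (x y : E3) : cross x (a • y) = a • cross x y := by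
  simp [cross]

lemma cross_self_eq_zero (x : E3) : cross x x = 0 := by
  simp [cross]

lemma cross_swap (x y : E3) : cross y x = -cross x y := by
  rw [cross, ← cross_anticomm]; rfl

lemma cross_cross_left (x y z : E3) :
    cross (cross x y) z = inner ℝ x z • y - inner ℝ y z • x := by
  ext i
  fin_cases i <;>
    simp [cross, cross_apply, PiLp.inner_apply, Fin.sum_univ_three] <;> ring

lemma inner_left_cross (x y : E3) : inner ℝ x (cross x y) = 0 := by
  simp [cross, cross_apply, PiLp.inner_apply, Fin.sum_univ_three]; ring

lemma inner_right_cross (x y : E3) : inner ℝ y (cross x y) = 0 := by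
  simp [cross, cross_apply, PiLp.inner_apply, Fin.sum_univ_three]; ring

lemma inner_cross_cross (x y z w : E3) : inner ℝ (cross x y) (cross z w) =
    inner ℝ x z * inner ℝ y w - inner ℝ x w * inner ℝ y z := by
  simp [cross, cross_apply, PiLp.inner_apply, Fin.sum_univ_three]; ring

lemma ContDiff.cross {f g : ℝ → E3} {n : WithTop ℕ∞} (hf : ContDiff ℝ n f) (hg : ContDiff ℝ n g) :
    ContDiff ℝ n (fun s => cross (f s) (g s)) := by
  rw [contDiff_euclidean] at hf hg ⊢
  have h0 := hf 0
  have h1 := hf 1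
  have h2 := hf 2
  have g0 := hg 0
  have g1 := hg 1
  have g2 := hg 2
  intro i
  fin_cases i <;> simp only [_root_.cross, cross_apply] <;> simp <;> fun_prop

/-- Two orthogonal unit vectors and their vector product form an orthonormal basis. -/
lemma eq_sum_inner_smul {T U : E3} (hT : inner ℝ T T = (1 : ℝ)) (hU : inner ℝ U U = (1 : ℝ))
    (hTU : inner ℝ T U = (0 : ℝ)) (x : E3) :
    x = inner ℝ x T • T + inner ℝ x U • U + inner ℝ x (cross T U) • cross T U := by
  have hUT : inner ℝ U T = (0 : ℝ) := by rw [real_inner_comm, hTU]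
  have h1 := cross_cross_left (cross T U) x (cross T U)
  have h2 : inner ℝ (cross T U) (cross T U) = (1 : ℝ) := by
    rw [inner_cross_cross, hT, hU, hTU]; norm_num
  have h3 := cross_cross_left T U x
  have h4 : cross U (cross T U) = T := by
    rw [cross_swap, cross_cross_left, hTU, hU]; simp
  have h5 : cross T (cross T U) = -U := by
    rw [cross_swap, cross_cross_left, hT, hUT]; simp
  rw [h3, h2, sub_eq_add_neg, ← neg_smul, cross_add_left, cross_smul_left, cross_smul_left, h4, h5,
    one_smul, real_inner_comm x T, real_inner_comm x U] at h1
  have h6 : x = inner ℝ x T • T - -(inner ℝ x U • U) + inner ℝ x (cross T U) • cross T U := by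
    rw [smul_neg, neg_smul, neg_neg] at h1
    rw [sub_neg_eq_add, h1, sub_add_cancel]
  rw [sub_neg_eq_add] at h6
  exact h6

/-- An orthonormal, positively oriented frame `T, U, V` along the unit speed curve `c`, with `T`
tangent, `U` and `V` parallel in the normal bundle, and `κ₁`, `-κ₂` the components of the curvature
vector along `U`, `V`. -/
structure IsParallelFrame (c T U V : ℝ → E3) (κ₁ κ₂ : ℝ → ℝ) : Prop where
  smooth_curve : ContDiff ℝ ∞ c
  smooth_T : ContDiff ℝ ∞ T
  smooth_U : ContDiff ℝ ∞ U
  smooth_V : ContDiff ℝ ∞ V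
  smooth_κ₁ : ContDiff ℝ ∞ κ₁
  smooth_κ₂ : ContDiff ℝ ∞ κ₂
  deriv_curve : ∀ s, HasDerivAt c (T s) s
  deriv_T : ∀ s, HasDerivAt T (κ₁ s • U s - κ₂ s • V s) s
  deriv_U : ∀ s, HasDerivAt U (-(κ₁ s) • T s) s
  deriv_V : ∀ s, HasDerivAt V (κ₂ s • T s) s
  inner_TT : ∀ s, inner ℝ (T s) (T s) = (1 : ℝ)
  inner_UU : ∀ s, inner ℝ (U s) (U s) = (1 : ℝ)
  inner_VV : ∀ s, inner ℝ (V s) (V s) = (1 : ℝ)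
  inner_TU : ∀ s, inner ℝ (T s) (U s) = (0 : ℝ)
  inner_TV : ∀ s, inner ℝ (T s) (V s) = (0 : ℝ)
  inner_UV : ∀ s, inner ℝ (U s) (V s) = (0 : ℝ)
  cross_TU : ∀ s, cross (T s) (U s) = V s

/-! ### The Frenet frame -/

namespace IsClosedFrenetCurve

variable {c : ℝ → E3} {L : ℝ}

lemma contDiff_tangent (hc : IsClosedFrenetCurve c L) : ContDiff ℝ ∞ (deriv c) :=
  (contDiff_infty_iff_deriv.1 hc.smooth).2

lemma contDiff_accel (hc : IsClosedFrenetCurve c L) : ContDiff ℝ ∞ (deriv (deriv c)) :=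
  (contDiff_infty_iff_deriv.1 hc.contDiff_tangent).2

lemma contDiff_curvature (hc : IsClosedFrenetCurve c L) : ContDiff ℝ ∞ (curvature c) :=
  hc.contDiff_accel.norm ℝ fun s => norm_pos_iff.1 (hc.curvature_pos s)

lemma contDiff_normal (hc : IsClosedFrenetCurve c L) : ContDiff ℝ ∞ (principalNormal c) :=
  (hc.contDiff_curvature.inv fun s => (hc.curvature_pos s).ne').smul hc.contDiff_accel

lemma contDiff_binormal (hc : IsClosedFrenetCurve c L) : ContDiff ℝ ∞ (binormal c) :=
  hc.contDiff_tangent.cross hc.contDiff_normal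

lemma contDiff_torsion (hc : IsClosedFrenetCurve c L) : ContDiff ℝ ∞ (torsion c) :=
  (contDiff_infty_iff_deriv.1 hc.contDiff_normal).2.inner ℝ hc.contDiff_binormal

lemma periodic_tangent (hc : IsClosedFrenetCurve c L) : Function.Periodic (deriv c) L := by
  intro s
  have h : (fun x => c (x + L)) = c := funext hc.periodic
  rw [← deriv_comp_add_const, h]

lemma periodic_accel (hc : IsClosedFrenetCurve c L) : Function.Periodic (deriv (deriv c)) L := by
  intro s
  have h : (fun x => deriv c (x + L)) = deriv c := funext hc.periodic_tangent
  rw [← deriv_comp_add_const, h]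

lemma periodic_curvature (hc : IsClosedFrenetCurve c L) : Function.Periodic (curvature c) L :=
  fun s => by simp only [curvature, hc.periodic_accel s]

lemma periodic_normal (hc : IsClosedFrenetCurve c L) : Function.Periodic (principalNormal c) L :=
  fun s => by simp only [principalNormal, hc.periodic_curvature s, hc.periodic_accel s]

lemma periodic_binormal (hc : IsClosedFrenetCurve c L) : Function.Periodic (binormal c) L :=
  fun s => by simp only [binormal, hc.periodic_tangent s, hc.periodic_normal s]

lemma periodic_torsion (hc : IsClosedFrenetCurve c L) : Function.Periodic (torsion c) L := by
  intro s
  have h : (fun x => principalNormal c (x + L)) = principalNormal c := funext hc.periodic_normal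
  have h' : deriv (principalNormal c) (s + L) = deriv (principalNormal c) s := by
    rw [← deriv_comp_add_const, h]
  simp only [torsion, h', hc.periodic_binormal s]

lemma inner_tangent (hc : IsClosedFrenetCurve c L) (s : ℝ) :
    inner ℝ (deriv c s) (deriv c s) = (1 : ℝ) := by
  rw [real_inner_self_eq_norm_sq, hc.unit_speed]; norm_num

lemma inner_normal (hc : IsClosedFrenetCurve c L) (s : ℝ) :
    inner ℝ (principalNormal c s) (principalNormal c s) = (1 : ℝ) := by
  have h := (hc.curvature_pos s).ne'
  rw [real_inner_self_eq_norm_sq, principalNormal, norm_smul, norm_inv, Real.norm_eq_abs,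
    abs_of_pos (hc.curvature_pos s)]
  change ((curvature c s)⁻¹ * curvature c s) ^ 2 = 1
  rw [inv_mul_cancel₀ h, one_pow]

lemma hasDerivAt_tangent (hc : IsClosedFrenetCurve c L) (s : ℝ) :
    HasDerivAt (deriv c) (curvature c s • principalNormal c s) s := by
  rw [principalNormal, smul_smul, mul_inv_cancel₀ (hc.curvature_pos s).ne', one_smul]
  exact (hc.contDiff_tangent.differentiable (by simp) s).hasDerivAt

lemma inner_tangent_normal (hc : IsClosedFrenetCurve c L) (s : ℝ) :
    inner ℝ (deriv c s) (principalNormal c s) = (0 : ℝ) := by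
  have h := (hc.hasDerivAt_tangent s).inner ℝ (hc.hasDerivAt_tangent s)
  simp only [hc.inner_tangent] at h
  have h0 := h.unique (hasDerivAt_const s (1 : ℝ))
  rw [real_inner_comm, inner_smul_left, ← two_mul, real_inner_comm] at h0
  simpa [(hc.curvature_pos s).ne'] using h0

lemma inner_binormal (hc : IsClosedFrenetCurve c L) (s : ℝ) :
    inner ℝ (binormal c s) (binormal c s) = (1 : ℝ) := by
  rw [binormal, inner_cross_cross, hc.inner_tangent, hc.inner_normal, hc.inner_tangent_normal]
  norm_num

lemma inner_tangent_binormal (s : ℝ) : inner ℝ (deriv c s) (binormal c s) = (0 : ℝ) :=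
  inner_left_cross _ _

lemma inner_normal_binormal (s : ℝ) : inner ℝ (principalNormal c s) (binormal c s) = (0 : ℝ) :=
  inner_right_cross _ _

lemma hasDerivAt_normal (hc : IsClosedFrenetCurve c L) (s : ℝ) :
    HasDerivAt (principalNormal c)
      (-curvature c s • deriv c s + torsion c s • binormal c s) s := by
  have hn := (hc.contDiff_normal.differentiable (by simp) s).hasDerivAt
  refine hn.congr_deriv ?_
  have h1 := (hn.inner ℝ (hc.hasDerivAt_tangent s))
  have h2 := (hn.inner ℝ hn)
  simp only [hc.inner_normal] at h2
  simp only [real_inner_comm (deriv c _) (principalNormal c _), hc.inner_tangent_normal,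
    inner_smul_right, hc.inner_normal] at h1
  have h1' := h1.unique (hasDerivAt_const s (0 : ℝ))
  have h2' := h2.unique (hasDerivAt_const s (1 : ℝ))
  rw [real_inner_comm, ← two_mul] at h2'
  have e := eq_sum_inner_smul (hc.inner_tangent s) (hc.inner_normal s) (hc.inner_tangent_normal s)
    (deriv (principalNormal c) s)
  have h2'' : inner ℝ (deriv (principalNormal c) s) (principalNormal c s) = (0 : ℝ) := by
    linarith
  have h1'' : inner ℝ (deriv (principalNormal c) s) (deriv c s) = -curvature c s := by
    linarith
  rw [h1'', h2'', zero_smul, add_zero] at e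
  exact e

lemma hasDerivAt_binormal (hc : IsClosedFrenetCurve c L) (s : ℝ) :
    HasDerivAt (binormal c) (-torsion c s • principalNormal c s) s := by
  have hb := (hc.contDiff_binormal.differentiable (by simp) s).hasDerivAt
  refine hb.congr_deriv ?_
  have h1 := hb.inner ℝ (hc.hasDerivAt_tangent s)
  have h2 := hb.inner ℝ (hc.hasDerivAt_normal s)
  have h3 := hb.inner ℝ hb
  simp only [real_inner_comm (deriv c _) (binormal c _), inner_tangent_binormal] at h1
  simp only [real_inner_comm (principalNormal c _) (binormal c _), inner_normal_binormal] at h2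
  simp only [hc.inner_binormal] at h3
  have h1' := h1.unique (hasDerivAt_const s (0 : ℝ))
  have h2' := h2.unique (hasDerivAt_const s (0 : ℝ))
  have h3' := h3.unique (hasDerivAt_const s (1 : ℝ))
  have hbt : inner ℝ (binormal c s) (deriv c s) = (0 : ℝ) := by
    rw [real_inner_comm, inner_tangent_binormal]
  have hbn : inner ℝ (binormal c s) (principalNormal c s) = (0 : ℝ) := by
    rw [real_inner_comm, inner_normal_binormal]
  rw [real_inner_comm, ← two_mul] at h3'
  rw [inner_smul_right, hbn, mul_zero, zero_add] at h1'
  rw [inner_add_right, inner_smul_right, inner_smul_right, hbt, hc.inner_binormal] at h2'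
  have e := eq_sum_inner_smul (hc.inner_tangent s) (hc.inner_normal s) (hc.inner_tangent_normal s)
    (deriv (binormal c) s)
  have h2'' : inner ℝ (deriv (binormal c) s) (principalNormal c s) = -torsion c s := by
    linarith
  have h3'' : inner ℝ (deriv (binormal c) s) (cross (deriv c s) (principalNormal c s)) = (0 : ℝ) := by
    change inner ℝ (deriv (binormal c) s) (binormal c s) = (0 : ℝ)
    linarith
  rw [h1', h2'', h3'', zero_smul, zero_smul, add_zero, zero_add] at e
  exact e

/-- Turning the normal plane of the Frenet frame by an angle `θ` with `θ' = -τ` cancels the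
torsion: the turned frame is parallel in the normal bundle. -/
lemma isParallelFrame (hc : IsClosedFrenetCurve c L) {θ : ℝ → ℝ}
    (hθ : ∀ s, HasDerivAt θ (-torsion c s) s) :
    IsParallelFrame c (deriv c)
      (fun s => Real.cos (θ s) • principalNormal c s + Real.sin (θ s) • binormal c s)
      (fun s => Real.cos (θ s) • binormal c s - Real.sin (θ s) • principalNormal c s)
      (fun s => curvature c s * Real.cos (θ s)) (fun s => curvature c s * Real.sin (θ s)) := by
  have hθs : ContDiff ℝ ∞ θ := by
    rw [contDiff_infty_iff_deriv]
    refine ⟨fun s => (hθ s).differentiableAt, ?_⟩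
    rw [show deriv θ = fun s => -torsion c s from funext fun s => (hθ s).deriv]
    exact hc.contDiff_torsion.neg
  have hk := hc.contDiff_curvature
  have hn := hc.contDiff_normal
  have hb := hc.contDiff_binormal
  have tt := hc.inner_tangent
  have nn := hc.inner_normal
  have bb := hc.inner_binormal
  have tn := hc.inner_tangent_normal
  have tb := fun s => inner_tangent_binormal (c := c) s
  have nb := fun s => inner_normal_binormal (c := c) s
  have bn : ∀ s, inner ℝ (binormal c s) (principalNormal c s) = (0 : ℝ) := fun s => by
    rw [real_inner_comm, nb]
  have hsc : ∀ s, Real.sin (θ s) * Real.sin (θ s) + Real.cos (θ s) * Real.cos (θ s) = 1 := fun s => by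
    nlinarith [Real.sin_sq_add_cos_sq (θ s)]
  refine ⟨hc.smooth, hc.contDiff_tangent, by fun_prop, by fun_prop, by fun_prop, by fun_prop,
    fun s => (hc.smooth.differentiable (by simp) s).hasDerivAt, fun s => ?_, fun s => ?_, fun s => ?_,
    tt, fun s => ?_, fun s => ?_, fun s => ?_, fun s => ?_, fun s => ?_, fun s => ?_⟩
  · refine (hc.hasDerivAt_tangent s).congr_deriv ?_
    rw [show curvature c s • principalNormal c s =
      (curvature c s * (Real.sin (θ s) * Real.sin (θ s) + Real.cos (θ s) * Real.cos (θ s))) •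
        principalNormal c s by rw [hsc, mul_one]]
    module
  · refine (((hθ s).cos.smul (hc.hasDerivAt_normal s)).add
      ((hθ s).sin.smul (hc.hasDerivAt_binormal s))).congr_deriv ?_
    module
  · refine (((hθ s).cos.smul (hc.hasDerivAt_binormal s)).sub
      ((hθ s).sin.smul (hc.hasDerivAt_normal s))).congr_deriv ?_
    module
  · simp only [inner_add_left, inner_add_right, inner_smul_left, inner_smul_right, nn, bb, nb, bn]
    simp; linarith [hsc s]
  · simp only [inner_sub_left, inner_sub_right, inner_smul_left, inner_smul_right, nn, bb, nb, bn]
    simp; linarith [hsc s]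
  · simp only [inner_add_right, inner_smul_right, tn, tb]
    simp
  · simp only [inner_sub_right, inner_smul_right, tn, tb]
    simp
  · simp only [inner_add_left, inner_sub_right, inner_smul_left, inner_smul_right, nn, bb, nb, bn]
    simp; ring
  · have htb : cross (deriv c s) (binormal c s) = -principalNormal c s := by
      rw [binormal, cross_swap, cross_cross_left, tt, real_inner_comm, tn]; simp
    rw [cross_add_right, cross_smul_right, cross_smul_right, htb]
    change Real.cos (θ s) • binormal c s + _ = _
    module

end IsClosedFrenetCurve

noncomputable section

/-! ### Fundamental forms of a ribbon -/

lemma partialU_eq {α : ℝ × ℝ → E3} {p : ℝ × ℝ} {y : E3} (hα : DifferentiableAt ℝ α p)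
    (h : HasDerivAt (fun s => α (s, p.2)) y p.1) : partialU α p = y := by
  have h1 : HasDerivAt (fun s : ℝ => (s, p.2)) ((1 : ℝ), (0 : ℝ)) p.1 :=
    (hasDerivAt_id p.1).prodMk (hasDerivAt_const p.1 p.2)
  exact (HasFDerivAt.comp_hasDerivAt (f := fun s : ℝ => (s, p.2)) p.1 hα.hasFDerivAt h1).unique h

lemma partialV_eq {α : ℝ × ℝ → E3} {p : ℝ × ℝ} {y : E3} (hα : DifferentiableAt ℝ α p)
    (h : HasDerivAt (fun v => α (p.1, v)) y p.2) : partialV α p = y := by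
  have h1 : HasDerivAt (fun v : ℝ => (p.1, v)) ((0 : ℝ), (1 : ℝ)) p.2 :=
    (hasDerivAt_const p.2 p.1).prodMk (hasDerivAt_id p.2)
  exact (HasFDerivAt.comp_hasDerivAt (f := fun v : ℝ => (p.1, v)) p.2 hα.hasFDerivAt h1).unique h

/-- The ribbon `c + v U + (A v² / 2) V` along `c`. -/
def ribbon (c U V : ℝ → E3) (A : ℝ → ℝ) (p : ℝ × ℝ) : E3 :=
  c p.1 + p.2 • U p.1 + (A p.1 * p.2 ^ 2 / 2) • V p.1

namespace IsParallelFrame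

variable {c T U V : ℝ → E3} {κ₁ κ₂ A : ℝ → ℝ}

lemma contDiff_ribbon (hF : IsParallelFrame c T U V κ₁ κ₂) (hA : ContDiff ℝ ∞ A) :
    ContDiff ℝ ∞ (ribbon c U V A) := by
  have := hF.smooth_curve
  have := hF.smooth_U
  have := hF.smooth_V
  unfold ribbon
  fun_prop

lemma partialU_ribbon (hF : IsParallelFrame c T U V κ₁ κ₂) (hA : ContDiff ℝ ∞ A) :
    partialU (ribbon c U V A) = fun p : ℝ × ℝ =>
      (1 - p.2 * κ₁ p.1 + A p.1 * p.2 ^ 2 / 2 * κ₂ p.1) • T p.1 +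
        (deriv A p.1 * p.2 ^ 2 / 2) • V p.1 := by
  funext ⟨s, v⟩
  refine partialU_eq ((hF.contDiff_ribbon hA).differentiable (by simp) _) ?_
  have hA' := (hA.differentiable (by simp) s).hasDerivAt
  refine (((hF.deriv_curve s).add ((hF.deriv_U s).const_smul v)).add
    (((hA'.mul_const (v ^ 2)).div_const 2).smul (hF.deriv_V s))).congr_deriv ?_
  module

lemma partialV_ribbon (hF : IsParallelFrame c T U V κ₁ κ₂) (hA : ContDiff ℝ ∞ A) :
    partialV (ribbon c U V A) = fun p : ℝ × ℝ => U p.1 + (A p.1 * p.2) • V p.1 := by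
  funext ⟨s, v⟩
  refine partialV_eq ((hF.contDiff_ribbon hA).differentiable (by simp) _) ?_
  refine (((hasDerivAt_const v (c s)).add ((hasDerivAt_id v).smul_const (U s))).add
    ((((hasDerivAt_pow 2 v).const_mul (A s)).div_const 2).smul_const (V s))).congr_deriv ?_
  simp only [Nat.cast_ofNat, Nat.add_one_sub_one, pow_one]
  module

lemma partialUU_ribbon (hF : IsParallelFrame c T U V κ₁ κ₂) (hA : ContDiff ℝ ∞ A) :
    partialU (partialU (ribbon c U V A)) = fun p : ℝ × ℝ =>
      (-(p.2 * deriv κ₁ p.1) + (deriv A p.1 * κ₂ p.1 + A p.1 * deriv κ₂ p.1) * p.2 ^ 2 / 2 +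
          deriv A p.1 * p.2 ^ 2 / 2 * κ₂ p.1) • T p.1 +
        ((1 - p.2 * κ₁ p.1 + A p.1 * p.2 ^ 2 / 2 * κ₂ p.1) * κ₁ p.1) • U p.1 +
        (deriv (deriv A) p.1 * p.2 ^ 2 / 2 -
          (1 - p.2 * κ₁ p.1 + A p.1 * p.2 ^ 2 / 2 * κ₂ p.1) * κ₂ p.1) • V p.1 := by
  have hT := hF.smooth_T
  have hV := hF.smooth_V
  have hκ₁ := hF.smooth_κ₁
  have hκ₂ := hF.smooth_κ₂
  have hA1 := (contDiff_infty_iff_deriv.1 hA).2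
  rw [hF.partialU_ribbon hA]
  funext ⟨s, v⟩
  refine partialU_eq (ContDiff.differentiable (n := ∞) (by fun_prop) (by simp) _) ?_
  have hA' := (hA.differentiable (by simp) s).hasDerivAt
  have hA'' := (hA1.differentiable (by simp) s).hasDerivAt
  have h1 := (hκ₁.differentiable (by simp) s).hasDerivAt
  have h2 := (hκ₂.differentiable (by simp) s).hasDerivAt
  refine ((((h1.const_mul v).const_sub 1).add
    (((hA'.mul_const (v ^ 2)).div_const 2).mul h2)).smul (hF.deriv_T s) |>.add
      (((hA''.mul_const (v ^ 2)).div_const 2).smul (hF.deriv_V s))).congr_deriv ?_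
  simp only [Pi.add_apply, Pi.mul_apply]
  module

lemma partialVU_ribbon (hF : IsParallelFrame c T U V κ₁ κ₂) (hA : ContDiff ℝ ∞ A) :
    partialV (partialU (ribbon c U V A)) = fun p : ℝ × ℝ =>
      (-κ₁ p.1 + A p.1 * κ₂ p.1 * p.2) • T p.1 + (deriv A p.1 * p.2) • V p.1 := by
  have hT := hF.smooth_T
  have hV := hF.smooth_V
  have hκ₁ := hF.smooth_κ₁
  have hκ₂ := hF.smooth_κ₂
  have hA1 := (contDiff_infty_iff_deriv.1 hA).2
  rw [hF.partialU_ribbon hA]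
  funext ⟨s, v⟩
  refine partialV_eq (ContDiff.differentiable (n := ∞) (by fun_prop) (by simp) _) ?_
  refine ((((((hasDerivAt_id v).mul_const (κ₁ s)).const_sub 1).add
    ((((hasDerivAt_pow 2 v).const_mul (A s)).div_const 2).mul_const (κ₂ s))).smul_const (T s)).add
      ((((hasDerivAt_pow 2 v).const_mul (deriv A s)).div_const 2).smul_const (V s))).congr_deriv ?_
  simp only [Nat.cast_ofNat, Nat.add_one_sub_one, pow_one]
  module

lemma partialVV_ribbon (hF : IsParallelFrame c T U V κ₁ κ₂) (hA : ContDiff ℝ ∞ A) :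
    partialV (partialV (ribbon c U V A)) = fun p : ℝ × ℝ => A p.1 • V p.1 := by
  have hU := hF.smooth_U
  have hV := hF.smooth_V
  rw [hF.partialV_ribbon hA]
  funext ⟨s, v⟩
  refine partialV_eq (ContDiff.differentiable (n := ∞) (by fun_prop) (by simp) _) ?_
  refine ((hasDerivAt_const v (U s)).add
    (((hasDerivAt_id v).const_mul (A s)).smul_const (V s))).congr_deriv ?_
  module

lemma inner_expand (hF : IsParallelFrame c T U V κ₁ κ₂) (s x y z x' y' z' : ℝ) :
    inner ℝ (x • T s + y • U s + z • V s) (x' • T s + y' • U s + z' • V s) =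
      x * x' + y * y' + z * z' := by
  have h1 := hF.inner_TT s
  have h2 := hF.inner_UU s
  have h3 := hF.inner_VV s
  have h4 := hF.inner_TU s
  have h5 := hF.inner_TV s
  have h6 := hF.inner_UV s
  have h4' := (real_inner_comm (T s) (U s)).trans h4
  have h5' := (real_inner_comm (T s) (V s)).trans h5
  have h6' := (real_inner_comm (U s) (V s)).trans h6
  simp only [inner_add_left, inner_add_right, real_inner_smul_left, inner_smul_right, h1, h2, h3, h4,
    h5, h6, h4', h5', h6']
  ring

lemma cross_expand (hF : IsParallelFrame c T U V κ₁ κ₂) (s x y z x' y' z' : ℝ) :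
    cross (x • T s + y • U s + z • V s) (x' • T s + y' • U s + z' • V s) =
      (y * z' - z * y') • T s + (z * x' - x * z') • U s + (x * y' - y * x') • V s := by
  have hTU := hF.cross_TU s
  have hUT : cross (U s) (T s) = -V s := by rw [cross_swap, hTU]
  have hVT : cross (V s) (T s) = U s := by
    rw [← hTU, cross_cross_left, hF.inner_TT, real_inner_comm, hF.inner_TU]; simp
  have hTV : cross (T s) (V s) = -U s := by rw [cross_swap, hVT]
  have hVU : cross (V s) (U s) = -T s := by
    rw [← hTU, cross_cross_left, hF.inner_UU, hF.inner_TU]; simp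
  have hUV : cross (U s) (V s) = T s := by rw [cross_swap, hVU, neg_neg]
  simp only [cross_add_left, cross_add_right, cross_smul_left, cross_smul_right, cross_self_eq_zero,
    hTU, hUT, hVT, hTV, hVU, hUV]
  module

end IsParallelFrame

/-- The functions `E, F, G` are the first fundamental form of `α`, the functions `e, f, g` are
proportional to the second one, and near `v = 0` they have the one-jets
`(1, 0, 1)` (with `F_v = 0`) and `(-κ, 0, A)` (with `f_v = A'`). The second form is only kept up to
a positive factor in order to avoid the normalization of the normal vector. -/
structure HasForms (α : ℝ × ℝ → E3) (κ A : ℝ → ℝ) (E F G e f g : ℝ × ℝ → ℝ) : Prop where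
  smooth_E : ContDiff ℝ ∞ E
  smooth_F : ContDiff ℝ ∞ F
  smooth_G : ContDiff ℝ ∞ G
  smooth_e : ContDiff ℝ ∞ e
  smooth_f : ContDiff ℝ ∞ f
  smooth_g : ContDiff ℝ ∞ g
  coeffE_eq : ∀ p, coeffE α p = E p
  coeffF_eq : ∀ p, coeffF α p = F p
  coeffG_eq : ∀ p, coeffG α p = G p
  second : ∀ p, 0 < E p * G p - F p ^ 2 →
    ∃ W > 0, coeffe α p = W * e p ∧ coefff α p = W * f p ∧ coeffg α p = W * g p
  E_zero : ∀ s, E (s, 0) = 1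
  F_zero : ∀ s, F (s, 0) = 0
  G_zero : ∀ s, G (s, 0) = 1
  e_zero : ∀ s, e (s, 0) = -κ s
  f_zero : ∀ s, f (s, 0) = 0
  g_zero : ∀ s, g (s, 0) = A s
  F_deriv : ∀ s, HasDerivAt (fun v => F (s, v)) 0 0
  f_deriv : ∀ s, HasDerivAt (fun v => f (s, v)) (deriv A s) 0

/-- The fundamental forms of a ribbon along a parallel frame. -/
lemma IsParallelFrame.exists_hasForms {c T U V : ℝ → E3} {κ₁ κ₂ A : ℝ → ℝ}
    (hF : IsParallelFrame c T U V κ₁ κ₂) (hA : ContDiff ℝ ∞ A) :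
    ∃ E F G e f g, HasForms (ribbon c U V A) κ₂ A E F G e f g := by
  have hκ₁ := hF.smooth_κ₁
  have hκ₂ := hF.smooth_κ₂
  have hA1 := (contDiff_infty_iff_deriv.1 hA).2
  have hA2 := (contDiff_infty_iff_deriv.1 hA1).2
  have hκ₁' := (contDiff_infty_iff_deriv.1 hκ₁).2
  have hκ₂' := (contDiff_infty_iff_deriv.1 hκ₂).2
  -- `α_u = a T + b V`, `α_v = U + q V`, so that `α_u ∧ α_v = -b T - a q U + a V`.
  obtain ⟨a, ha⟩ : ∃ a : ℝ × ℝ → ℝ,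
    a = fun p => 1 - p.2 * κ₁ p.1 + A p.1 * p.2 ^ 2 / 2 * κ₂ p.1 := ⟨_, rfl⟩
  obtain ⟨b, hb⟩ : ∃ b : ℝ × ℝ → ℝ, b = fun p => deriv A p.1 * p.2 ^ 2 / 2 := ⟨_, rfl⟩
  obtain ⟨q, hq⟩ : ∃ q : ℝ × ℝ → ℝ, q = fun p => A p.1 * p.2 := ⟨_, rfl⟩
  obtain ⟨a', ha'⟩ : ∃ a' : ℝ × ℝ → ℝ, a' = fun p =>
    -(p.2 * deriv κ₁ p.1) + (deriv A p.1 * κ₂ p.1 + A p.1 * deriv κ₂ p.1) * p.2 ^ 2 / 2 +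
          deriv A p.1 * p.2 ^ 2 / 2 * κ₂ p.1 := ⟨_, rfl⟩
  obtain ⟨b', hb'⟩ : ∃ b' : ℝ × ℝ → ℝ, b' = fun p => deriv (deriv A) p.1 * p.2 ^ 2 / 2 := ⟨_, rfl⟩
  have sa : ContDiff ℝ ∞ a := by rw [ha]; fun_prop
  have sb : ContDiff ℝ ∞ b := by rw [hb]; fun_prop
  have sq : ContDiff ℝ ∞ q := by rw [hq]; fun_prop
  have sa' : ContDiff ℝ ∞ a' := by rw [ha']; fun_prop
  have sb' : ContDiff ℝ ∞ b' := by rw [hb']; fun_prop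
  have eU : ∀ p, partialU (ribbon c U V A) p = a p • T p.1 + (0 : ℝ) • U p.1 + b p • V p.1 := by
    intro p; rw [hF.partialU_ribbon hA, ha, hb, zero_smul, add_zero]
  have eV : ∀ p, partialV (ribbon c U V A) p =
      (0 : ℝ) • T p.1 + (1 : ℝ) • U p.1 + q p • V p.1 := by
    intro p; rw [hF.partialV_ribbon hA, hq, zero_smul, zero_add, one_smul]
  have eUU : ∀ p, partialU (partialU (ribbon c U V A)) p =
      a' p • T p.1 + (a p * κ₁ p.1) • U p.1 + (b' p - a p * κ₂ p.1) • V p.1 := by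
    intro p; rw [hF.partialUU_ribbon hA, ha, ha', hb']
  have eVU : ∀ p, partialV (partialU (ribbon c U V A)) p =
      (-κ₁ p.1 + A p.1 * κ₂ p.1 * p.2) • T p.1 + (0 : ℝ) • U p.1 + (deriv A p.1 * p.2) • V p.1 := by
    intro p; rw [hF.partialVU_ribbon hA, zero_smul, add_zero]
  have eVV : ∀ p, partialV (partialV (ribbon c U V A)) p =
      (0 : ℝ) • T p.1 + (0 : ℝ) • U p.1 + A p.1 • V p.1 := by
    intro p; rw [hF.partialVV_ribbon hA, zero_smul, zero_smul, add_zero, zero_add]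
  refine ⟨fun p => a p ^ 2 + b p ^ 2, fun p => b p * q p, fun p => 1 + q p ^ 2,
    fun p => -(b p * a' p) - a p * q p * (a p * κ₁ p.1) + a p * (b' p - a p * κ₂ p.1),
    fun p => -(b p * (-κ₁ p.1 + A p.1 * κ₂ p.1 * p.2)) + a p * (deriv A p.1 * p.2),
    fun p => a p * A p.1,
    by fun_prop, by fun_prop, by fun_prop, by fun_prop, by fun_prop, by fun_prop,
    fun p => ?_, fun p => ?_, fun p => ?_, fun p hp => ?_, fun s => ?_, fun s => ?_, fun s => ?_,
    fun s => ?_, fun s => ?_, fun s => ?_, fun s => ?_, fun s => ?_⟩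
  · rw [coeffE, eU, hF.inner_expand]; ring
  · rw [coeffF, eU, eV, hF.inner_expand]; ring
  · rw [coeffG, eV, hF.inner_expand]; ring
  · have hX := hF.cross_expand p.1 (a p) 0 (b p) 0 1 (q p)
    rw [← eU, ← eV] at hX
    refine ⟨‖cross (partialU (ribbon c U V A) p) (partialV (ribbon c U V A) p)‖⁻¹,
      inv_pos.2 (norm_pos_iff.2 fun h0 => ?_), ?_, ?_, ?_⟩
    · have h1 := inner_cross_cross (partialU (ribbon c U V A) p) (partialV (ribbon c U V A) p)
        (partialU (ribbon c U V A) p) (partialV (ribbon c U V A) p)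
      rw [h0, inner_zero_left, real_inner_comm (partialU (ribbon c U V A) p)
        (partialV (ribbon c U V A) p), eU, eV, hF.inner_expand, hF.inner_expand,
        hF.inner_expand] at h1
      nlinarith
    · rw [coeffe, unitNormal, real_inner_smul_left, eUU, hX, hF.inner_expand]; ring
    · rw [coefff, unitNormal, real_inner_smul_left, eVU, hX, hF.inner_expand]; ring
    · rw [coeffg, unitNormal, real_inner_smul_left, eVV, hX, hF.inner_expand]; ring
  · simp [ha, hb]
  · simp [hb]
  · simp [hq]
  · simp [ha, hb, hq, hb']
  · simp [ha, hb]
  · simp [ha]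
  · -- `F = A A' v³ / 2`
    refine HasDerivAt.congr_deriv (f' := deriv A s * A s / 2 * ((3 : ℕ) * 0 ^ 2)) ?_ (by simp)
    refine ((hasDerivAt_pow 3 (0 : ℝ)).const_mul (deriv A s * A s / 2)).congr_of_eventuallyEq ?_
    exact Eventually.of_forall fun v => by simp only [hb, hq]; ring
  · -- `f` is `v` times a function with the value `A'` at `v = 0`
    have hd : DifferentiableAt ℝ (fun v : ℝ => -(deriv A s * v / 2 *
        (-κ₁ s + A s * κ₂ s * v)) + a (s, v) * deriv A s) 0 := by
      simp only [ha]; fun_prop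
    refine (((hasDerivAt_id (0 : ℝ)).mul hd.hasDerivAt).congr_deriv ?_).congr_of_eventuallyEq ?_
    · simp [ha]
    · exact Eventually.of_forall fun v => by simp only [hb, Pi.mul_apply, id]; ring

/-! ### The minimal principal direction field -/

/-- If `P` solves the quadratic equation of the principal directions and is its root with
`M + 2 L P > 0`, then the ratio of the quadratic forms is minimal in the direction `(1, P)`. -/
lemma ratio_le_ratio {E F G e f g P : ℝ} (hE : 0 < E) (hD : 0 < E * G - F ^ 2)
    (hP : (F * g - G * f) * P ^ 2 + (E * g - G * e) * P + (E * f - F * e) = 0)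
    (hM : 0 ≤ E * g - G * e + 2 * (F * g - G * f) * P) (x y : ℝ) (hxy : x ≠ 0 ∨ y ≠ 0) :
    (e + 2 * f * P + g * P ^ 2) / (E + 2 * F * P + G * P ^ 2) ≤
      (e * x ^ 2 + 2 * f * x * y + g * y ^ 2) / (E * x ^ 2 + 2 * F * x * y + G * y ^ 2) := by
  have pos : ∀ x y : ℝ, x ≠ 0 ∨ y ≠ 0 → 0 < E * x ^ 2 + 2 * F * x * y + G * y ^ 2 := by
    intro x y h
    have h1 : E * (E * x ^ 2 + 2 * F * x * y + G * y ^ 2) =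
        (E * x + F * y) ^ 2 + (E * G - F ^ 2) * y ^ 2 := by ring
    refine pos_of_mul_pos_right (a := E) ?_ hE.le
    rw [h1]
    rcases eq_or_ne y 0 with rfl | hy
    · have hx : x ≠ 0 := by simpa using h
      have : E * x ≠ 0 := mul_ne_zero hE.ne' hx
      have := pow_pos (abs_pos.2 this) 2
      rw [sq_abs] at this
      simpa using this
    · have := mul_pos hD (sq_pos_of_ne_zero hy)
      nlinarith [sq_nonneg (E * x + F * y)]
  have h1 := pos 1 P (Or.inl one_ne_zero)
  have h2 := pos x y hxy
  have h1' : 0 < E + 2 * F * P + G * P ^ 2 := by linarith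
  rw [div_le_div_iff₀ h1' h2]
  have h3 := mul_nonneg hM (sq_nonneg (y - P * x))
  -- the difference of the two sides is `(M + 2 L P) (y - P x)²` modulo the equation for `P`
  have h4 : (e * x ^ 2 + 2 * f * x * y + g * y ^ 2) * (E + 2 * F * P + G * P ^ 2) -
      (e + 2 * f * P + g * P ^ 2) * (E * x ^ 2 + 2 * F * x * y + G * y ^ 2) =
      (E * g - G * e + 2 * (F * g - G * f) * P) * (y - P * x) ^ 2 := by
    linear_combination 2 * x * (y - P * x) * hP
  linarith

/-- The slope of the minimal principal direction: the root `-2 N / (M + √(M² - 4 L N))` of the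
quadratic equation `L P² + M P + N = 0`, which stays smooth where `L = 0`. -/
def principalSlope (E F G e f g : ℝ × ℝ → ℝ) (p : ℝ × ℝ) : ℝ :=
  -2 * (E p * f p - F p * e p) / (E p * g p - G p * e p + √((E p * g p - G p * e p) ^ 2 -
    4 * (F p * g p - G p * f p) * (E p * f p - F p * e p)))

lemma quadratic_root {l m n : ℝ} (hm : 0 < m) (hd : 0 < m ^ 2 - 4 * l * n) :
    l * (-2 * n / (m + √(m ^ 2 - 4 * l * n))) ^ 2 + m * (-2 * n / (m + √(m ^ 2 - 4 * l * n))) + n = 0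
    ∧ 0 < m + 2 * l * (-2 * n / (m + √(m ^ 2 - 4 * l * n))) := by
  have hs := Real.sqrt_pos.2 hd
  have hq := Real.sq_sqrt hd.le
  set r := √(m ^ 2 - 4 * l * n)
  have hmr : m + r ≠ 0 := by positivity
  constructor
  · field_simp
    linear_combination n * hq
  · have : m + 2 * l * (-2 * n / (m + r)) = r := by
      field_simp
      linear_combination -hq
    rwa [this]

namespace HasForms

variable {α : ℝ × ℝ → E3} {κ A : ℝ → ℝ} {E F G e f g : ℝ × ℝ → ℝ}

lemma principalSlope_zero (h : HasForms α κ A E F G e f g) (s : ℝ) :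
    principalSlope E F G e f g (s, 0) = 0 := by
  simp [principalSlope, h.F_zero, h.f_zero]

lemma eventually_pos (h : HasForms α κ A E F G e f g) {s : ℝ} (hs : 0 < A s + κ s) :
    ∀ᶠ p in 𝓝 (s, (0 : ℝ)), 0 < E p ∧ 0 < E p * G p - F p ^ 2 ∧ 0 < E p * g p - G p * e p ∧
      0 < (E p * g p - G p * e p) ^ 2 -
        4 * (F p * g p - G p * f p) * (E p * f p - F p * e p) := by
  have cE := h.smooth_E.continuous
  have cF := h.smooth_F.continuous
  have cG := h.smooth_G.continuous
  have ce := h.smooth_e.continuous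
  have cf := h.smooth_f.continuous
  have cg := h.smooth_g.continuous
  have key : ∀ u : ℝ × ℝ → ℝ, Continuous u → 0 < u (s, 0) → ∀ᶠ p in 𝓝 (s, (0 : ℝ)), 0 < u p :=
    fun u hu h0 => hu.continuousAt.eventually (lt_mem_nhds h0)
  refine (key _ cE ?_).and ((key _ (by fun_prop) ?_).and
    ((key _ (by fun_prop) ?_).and (key _ (by fun_prop) ?_)))
  · simp [h.E_zero]
  · simp [h.E_zero, h.F_zero, h.G_zero]
  · simpa [h.E_zero, h.G_zero, h.g_zero, h.e_zero] using hs
  · simp only [h.E_zero, h.G_zero, h.g_zero, h.e_zero, h.F_zero, h.f_zero]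
    nlinarith [sq_pos_of_pos hs]

lemma contDiffAt_principalSlope (h : HasForms α κ A E F G e f g) {p : ℝ × ℝ}
    (hM : 0 < E p * g p - G p * e p)
    (hd : 0 < (E p * g p - G p * e p) ^ 2 -
        4 * (F p * g p - G p * f p) * (E p * f p - F p * e p)) :
    ContDiffAt ℝ ∞ (principalSlope E F G e f g) p := by
  have cE := h.smooth_E.contDiffAt (x := p)
  have cF := h.smooth_F.contDiffAt (x := p)
  have cG := h.smooth_G.contDiffAt (x := p)
  have ce := h.smooth_e.contDiffAt (x := p)
  have cf := h.smooth_f.contDiffAt (x := p)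
  have cg := h.smooth_g.contDiffAt (x := p)
  have hM' := ((cE.mul cg).sub (cG.mul ce))
  unfold principalSlope
  refine ContDiffAt.div (contDiffAt_const.mul ((cE.mul cf).sub (cF.mul ce)))
    (hM'.add (((hM'.pow 2).sub ((contDiffAt_const.mul ((cF.mul cg).sub (cG.mul cf))).mul
      ((cE.mul cf).sub (cF.mul ce)))).sqrt hd.ne')) ?_
  have := Real.sqrt_nonneg ((E p * g p - G p * e p) ^ 2 -
        4 * (F p * g p - G p * f p) * (E p * f p - F p * e p))
  positivity

/-- The linearization of the principal direction field along `v = 0`. -/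
lemma hasDerivAt_principalSlope (h : HasForms α κ A E F G e f g) {s : ℝ} (hs : 0 < A s + κ s) :
    HasDerivAt (fun v => principalSlope E F G e f g (s, v)) (-(deriv A s / (A s + κ s))) 0 := by
  obtain ⟨-, -, hM, hd⟩ := (h.eventually_pos hs).self_of_nhds
  have dP := (h.contDiffAt_principalSlope hM hd).differentiableAt (by simp)
  have hv : ∀ u : ℝ × ℝ → ℝ, ContDiff ℝ ∞ u →
      HasDerivAt (fun v => u (s, v)) (deriv (fun v => u (s, v)) 0) 0 := fun u hu =>
    (ContDiff.differentiable (n := ∞) (by fun_prop) (by simp) _).hasDerivAt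
  have hN := ((hv E h.smooth_E).mul (h.f_deriv s)).sub ((h.F_deriv s).mul (hv e h.smooth_e))
  have dP' : DifferentiableAt ℝ (fun v => principalSlope E F G e f g (s, v)) 0 := by
    have h1 : HasDerivAt (fun v : ℝ => (s, v)) ((0 : ℝ), (1 : ℝ)) 0 :=
      (hasDerivAt_const 0 s).prodMk (hasDerivAt_id 0)
    exact (HasFDerivAt.comp_hasDerivAt (f := fun v : ℝ => (s, v)) 0 dP.hasFDerivAt
      h1).differentiableAt
  -- differentiate the quadratic equation satisfied by the slope
  have hL := (((hv F h.smooth_F).mul (hv g h.smooth_g)).sub ((hv G h.smooth_G).mul (h.f_deriv s)))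
  have hMd := (((hv E h.smooth_E).mul (hv g h.smooth_g)).sub
    ((hv G h.smooth_G).mul (hv e h.smooth_e)))
  have hQ := ((hL.mul (dP'.hasDerivAt.pow 2)).add (hMd.mul dP'.hasDerivAt)).add hN
  have h0 := hQ.unique ((hasDerivAt_const 0 (0 : ℝ)).congr_of_eventuallyEq ?_)
  · simp [h.principalSlope_zero, h.E_zero, h.F_zero, h.G_zero, h.e_zero, h.f_zero,
      h.g_zero] at h0
    refine dP'.hasDerivAt.congr_deriv ?_
    rw [eq_neg_iff_add_eq_zero, ← mul_right_inj' hs.ne']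
    field_simp
    linarith
  · have hc : Continuous fun v : ℝ => (s, v) := by fun_prop
    filter_upwards [hc.continuousAt.eventually (h.eventually_pos hs)] with v hvv
    exact (quadratic_root hvv.2.2.1 hvv.2.2.2).1

/-- Where the forms are close to those on `v = 0`, the slope does give the line field of the minimal
principal foliation. -/
lemma principal_direction (h : HasForms α κ A E F G e f g) {p : ℝ × ℝ} (hE : 0 < E p)
    (hD : 0 < E p * G p - F p ^ 2) (hM : 0 < E p * g p - G p * e p)
    (hd : 0 < (E p * g p - G p * e p) ^ 2 -
        4 * (F p * g p - G p * f p) * (E p * f p - F p * e p)) :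
    ¬ IsUmbilic α p ∧ PrincipalEquation α p (1, principalSlope E F G e f g p) ∧
      MinimalDirection α p (1, principalSlope E F G e f g p) := by
  obtain ⟨W, hW, he, hf, hg⟩ := h.second p hD
  obtain ⟨hr, hpos⟩ := quadratic_root hM hd
  change _ * principalSlope E F G e f g p ^ 2 + _ * principalSlope E F G e f g p + _ = 0 at hr
  change 0 < _ + _ * principalSlope E F G e f g p at hpos
  set P := principalSlope E F G e f g p
  refine ⟨fun hu => ?_, ?_, fun w hw => ?_⟩
  · have := hu.2.1
    rw [h.coeffE_eq, h.coeffG_eq, he, hg] at this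
    have : W * (E p * g p - G p * e p) = 0 := by linarith
    exact (mul_pos hW hM).ne' this
  · simp only [PrincipalEquation, h.coeffE_eq, h.coeffF_eq, h.coeffG_eq, he, hf, hg]
    linear_combination W * hr
  · simp only [normalCurvature, h.coeffE_eq, h.coeffF_eq, h.coeffG_eq, he, hf, hg]
    have hw' : w.1 ≠ 0 ∨ w.2 ≠ 0 := by
      by_contra! h0
      exact hw (Prod.ext h0.1 h0.2)
    have := ratio_le_ratio (e := W * e p) (f := W * f p) (g := W * g p) hE hD
      (P := P) (by linear_combination W * hr) (by nlinarith) w.1 w.2 hw'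
    simpa using this

/-- Where `E G - F² > 0` the surface is immersed. -/
lemma linearIndependent (h : HasForms α κ A E F G e f g) {p : ℝ × ℝ}
    (hD : 0 < E p * G p - F p ^ 2) : LinearIndependent ℝ ![partialU α p, partialV α p] := by
  rw [LinearIndependent.pair_iff]
  intro x y hxy
  have h1 : x * E p + y * F p = 0 := by
    have := congrArg (fun z => inner ℝ z (partialU α p)) hxy
    simp only [inner_add_left, real_inner_smul_left, inner_zero_left] at this
    rw [← h.coeffE_eq, ← h.coeffF_eq, coeffE, coeffF, ← this,
      real_inner_comm (partialU α p) (partialV α p)]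
  have h2 : x * F p + y * G p = 0 := by
    have := congrArg (fun z => inner ℝ z (partialV α p)) hxy
    simp only [inner_add_left, real_inner_smul_left, inner_zero_left] at this
    rw [← h.coeffF_eq, ← h.coeffG_eq, coeffF, coeffG, ← this]
  constructor
  · have : x * (E p * G p - F p ^ 2) = 0 := by linear_combination G p * h1 - F p * h2
    exact (mul_eq_zero.1 this).resolve_right hD.ne'
  · have : y * (E p * G p - F p ^ 2) = 0 := by linear_combination E p * h2 - F p * h1
    exact (mul_eq_zero.1 this).resolve_right hD.ne'

end HasForms

/-! ### The transition map of a scalar equation near a solution -/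

lemma exists_pos_forall_of_eventually {T : ℝ} {C : ℝ × ℝ → Prop}
    (h : ∀ t ∈ Icc 0 T, ∀ᶠ q in 𝓝 (t, (0 : ℝ)), C q) :
    ∃ δ > 0, ∀ t ∈ Icc 0 T, ∀ v : ℝ, |v| ≤ δ → C (t, v) := by
  have hsub : Icc 0 T ×ˢ {(0 : ℝ)} ⊆ interior {q | C q} := by
    rintro ⟨t, v⟩ ⟨ht, hv⟩
    obtain rfl : v = 0 := hv
    exact mem_interior_iff_mem_nhds.2 (h t ht)
  obtain ⟨u, w, -, hw, hu, hw0, huw⟩ :=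
    generalized_tube_lemma isCompact_Icc isCompact_singleton isOpen_interior hsub
  obtain ⟨δ, hδ, hball⟩ := Metric.nhds_basis_closedBall.mem_iff.1
    (hw.mem_nhds (hw0 (mem_singleton (0 : ℝ))))
  refine ⟨δ, hδ, fun t ht v hv => interior_subset (huw ⟨hu ht, hball ?_⟩)⟩
  simpa [Real.dist_eq] using hv

/-- Solutions of a globally Lipschitz, bounded equation with the solution `0`. -/
lemma exists_solution_of_lipschitz {f : ℝ → ℝ → ℝ} {T : ℝ} (hT : 0 ≤ T) {C : NNReal} {M : ℝ}
    (hlip : ∀ t ∈ Icc 0 T, LipschitzWith C (f t))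
    (hcont : ∀ x, ContinuousOn (fun t => f t x) (Icc 0 T))
    (hM : ∀ t ∈ Icc 0 T, ∀ x, |f t x| ≤ M) (h0 : ∀ t ∈ Icc 0 T, f t 0 = 0) (x : ℝ) :
    ∃ v : ℝ → ℝ, v 0 = x ∧ (∀ t ∈ Icc 0 T, HasDerivWithinAt v (f t (v t)) (Icc 0 T) t) ∧
      ∀ t ∈ Icc 0 T, |v t| ≤ |x| * Real.exp (C * T) := by
  have hM0 : 0 ≤ M := (abs_nonneg _).trans (hM 0 ⟨le_rfl, hT⟩ 0)
  have hpl : IsPicardLindelof f (tmin := 0) (tmax := T) ⟨0, le_rfl, hT⟩ x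
      ⟨M * T, mul_nonneg hM0 hT⟩ 0 ⟨M, hM0⟩ C := by
    refine ⟨fun t ht => (hlip t ht).lipschitzOnWith, fun y _ => hcont y,
      fun t ht y _ => hM t ht y, ?_⟩
    simp only [sub_zero, max_eq_left hT, NNReal.coe_zero, sub_self]
    exact le_of_eq rfl
  obtain ⟨v, hv0, hv⟩ := hpl.exists_eq_forall_mem_Icc_hasDerivWithinAt₀
  refine ⟨v, hv0, hv, fun t ht => ?_⟩
  have hg := norm_le_gronwallBound_of_norm_deriv_right_le (f := v) (f' := fun t => f t (v t))
    (δ := |x|) (K := C) (ε := 0) (a := 0) (b := T)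
    (fun t ht => (hv t ht).continuousWithinAt)
    (fun t ht => (hv t (Ico_subset_Icc_self ht)).mono_of_mem_nhdsWithin (Icc_mem_nhdsGE_of_mem ht))
    (by rw [← hv0]; rfl) (fun t ht => ?_) t ht
  · rw [gronwallBound_ε0, sub_zero] at hg
    refine hg.trans (mul_le_mul_of_nonneg_left (Real.exp_le_exp.2 ?_) (abs_nonneg x))
    exact mul_le_mul_of_nonneg_left ht.2 C.2
  · have := (hlip t (Ico_subset_Icc_self ht)).dist_le_mul (v t) 0
    rw [h0 t (Ico_subset_Icc_self ht), dist_zero_right, dist_zero_right] at this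
    simpa using this

/-- The scalar equation `v' = P (t, v)` with the solution `v = 0` has a transition map from `t = 0`
to `t = T`, whose derivative at `0` is the transition map of the linearized equation `v' = p v`. -/
theorem exists_transitionMap {P : ℝ × ℝ → ℝ} {p : ℝ → ℝ} {T δ : ℝ} (hT : 0 < T) (hδ : 0 < δ)
    (hsm : ∀ t ∈ Icc 0 T, ContDiffAt ℝ 1 P (t, 0)) (h0 : ∀ t ∈ Icc 0 T, P (t, 0) = 0)
    (hpc : Continuous p) (hp : ∀ t ∈ Icc 0 T, HasDerivAt (fun v => P (t, v)) (p t) 0) :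
    ∃ π : ℝ → ℝ, HasDerivAt π (Real.exp (∫ t in (0 : ℝ)..T, p t)) 0 ∧
      ∃ η > 0, ∀ x, |x| < η → ∃ v : ℝ → ℝ, v 0 = x ∧ v T = π x ∧
        ∀ t ∈ Icc 0 T, |v t| < δ ∧ HasDerivWithinAt v (P (t, v t)) (Icc 0 T) t := by
  have hsm' : ∀ t ∈ Icc 0 T, ∀ᶠ q in 𝓝 (t, (0 : ℝ)), ContDiffAt ℝ 1 P q := fun t ht =>
    (hsm t ht).eventually (by simp)
  obtain ⟨δ₁, hδ₁, hC1⟩ := exists_pos_forall_of_eventually hsm'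
  set D : ℝ × ℝ → ℝ := fun q => fderiv ℝ P q (0, 1) with hD
  have hDc : ∀ t ∈ Icc 0 T, ∀ v : ℝ, |v| ≤ δ₁ → ContinuousAt D (t, v) := fun t ht v hv =>
    ((hC1 t ht v hv).continuousAt_fderiv one_ne_zero).clm_apply continuousAt_const
  have hder : ∀ t ∈ Icc 0 T, ∀ v : ℝ, |v| ≤ δ₁ → HasDerivAt (fun v => P (t, v)) (D (t, v)) v := by
    intro t ht v hv
    have h1 : HasDerivAt (fun v : ℝ => (t, v)) ((0 : ℝ), (1 : ℝ)) v :=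
      (hasDerivAt_const v t).prodMk (hasDerivAt_id v)
    exact HasFDerivAt.comp_hasDerivAt (f := fun v : ℝ => (t, v)) v
      ((hC1 t ht v hv).differentiableAt one_ne_zero).hasFDerivAt h1
  have hD0 : ∀ t ∈ Icc 0 T, D (t, 0) = p t := fun t ht =>
    (hder t ht 0 (by simpa using hδ₁.le)).unique (hp t ht)
  have hI : ∀ v : ℝ, v ∈ Icc (-δ₁) δ₁ ↔ |v| ≤ δ₁ := fun v => abs_le.symm
  -- a Lipschitz constant on the compact strip
  obtain ⟨C₀, hC₀⟩ := (isCompact_Icc (a := (0 : ℝ)) (b := T)).prod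
    (isCompact_Icc (a := -δ₁) (b := δ₁)) |>.exists_bound_of_continuousOn (f := D)
    (fun q hq => (hDc q.1 hq.1 q.2 ((hI _).1 hq.2)).continuousWithinAt)
  set C : NNReal := Real.toNNReal C₀ with hC
  have hle : -δ₁ ≤ δ₁ := by linarith
  -- outside of the strip the equation is replaced by a bounded one
  set f : ℝ → ℝ → ℝ := fun t v => P (t, projIcc (-δ₁) δ₁ hle v) with hf
  have hproj : ∀ v : ℝ, |(projIcc (-δ₁) δ₁ hle v : ℝ)| ≤ δ₁ := fun v =>
    (hI _).1 (projIcc (-δ₁) δ₁ hle v).2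
  have hlip : ∀ t ∈ Icc 0 T, LipschitzWith C (f t) := by
    intro t ht
    have h1 : LipschitzOnWith C (fun v => P (t, v)) (Icc (-δ₁) δ₁) := by
      refine (convex_Icc _ _).lipschitzOnWith_of_nnnorm_hasDerivWithin_le
        (f' := fun v => D (t, v))
        (fun v hv => (hder t ht v ((hI _).1 hv)).hasDerivWithinAt) fun v hv => ?_
      rw [hC, ← NNReal.coe_le_coe, coe_nnnorm]
      exact (hC₀ (t, v) ⟨ht, hv⟩).trans (Real.le_coe_toNNReal _)
    have h2 := (lipschitzOnWith_iff_restrict.1 h1).comp (LipschitzWith.projIcc hle)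
    rw [mul_one] at h2
    exact h2
  have hf0 : ∀ t ∈ Icc 0 T, f t 0 = 0 := by
    intro t ht
    have h0mem : (0 : ℝ) ∈ Icc (-δ₁) δ₁ := (hI 0).2 (by simpa using hδ₁.le)
    simp only [hf, projIcc_of_mem hle h0mem, h0 t ht]
  have hfc : ∀ x, ContinuousOn (fun t => f t x) (Icc 0 T) := by
    intro x t ht
    have h1 : ContinuousAt P (t, ↑(projIcc (-δ₁) δ₁ hle x)) := (hC1 t ht _ (hproj x)).continuousAt
    have h2 : ContinuousAt (fun t : ℝ => (t, (projIcc (-δ₁) δ₁ hle x : ℝ))) t := by fun_prop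
    exact (ContinuousAt.comp (f := fun t : ℝ => (t, (projIcc (-δ₁) δ₁ hle x : ℝ)))
      h1 h2).continuousWithinAt
  have hfM : ∀ t ∈ Icc 0 T, ∀ x, |f t x| ≤ C * δ₁ := by
    intro t ht x
    have hPlip := (hlip t ht).dist_le_mul (projIcc (-δ₁) δ₁ hle x : ℝ) 0
    rw [hf0 t ht, dist_zero_right, dist_zero_right] at hPlip
    simp only [hf, projIcc_val, Real.norm_eq_abs] at hPlip
    exact hPlip.trans (mul_le_mul_of_nonneg_left (hproj x) C.2)
  choose v hv0 hv hvb using exists_solution_of_lipschitz hT.le hlip hfc hfM hf0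
  have hvP : ∀ x t, t ∈ Icc 0 T → |v x t| ≤ δ₁ →
      HasDerivWithinAt (v x) (P (t, v x t)) (Icc 0 T) t := by
    intro x t ht hle'
    have := hv x t ht
    simp only [hf, projIcc_of_mem hle ((hI _).2 hle')] at this
    exact this
  set Ex := Real.exp (C * T) with hEx
  have hExpos : 0 < Ex := Real.exp_pos _
  have hsmall : ∀ (x : ℝ) (r : ℝ), |x| < r / Ex → ∀ t ∈ Icc 0 T, |v x t| < r := fun x r hx t ht =>
    (hvb x t ht).trans_lt ((lt_div_iff₀ hExpos).1 hx)
  refine ⟨fun x => v x T, ?_, min δ δ₁ / Ex, div_pos (lt_min hδ hδ₁) hExpos, fun x hx =>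
    ⟨v x, hv0 x, rfl, fun t ht => ⟨(hsmall x _ hx t ht).trans_le (min_le_left _ _),
      hvP x t ht ((hsmall x _ hx t ht).le.trans (min_le_right _ _))⟩⟩⟩
  -- the derivative of the transition map
  set I : ℝ → ℝ := fun t => ∫ s in (0 : ℝ)..t, p s with hIdef
  have hId : ∀ t, HasDerivAt I (p t) t := fun t =>
    intervalIntegral.integral_hasDerivAt_right (hpc.intervalIntegrable _ _)
      hpc.stronglyMeasurable.stronglyMeasurableAtFilter hpc.continuousAt
  have hIc : Continuous I := continuous_iff_continuousAt.2 fun t => (hId t).continuousAt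
  obtain ⟨B, hB⟩ := (isCompact_Icc (a := (0 : ℝ)) (b := T)).exists_bound_of_continuousOn
    (f := fun t => Real.exp (-I t)) (by fun_prop)
  have hB0 : 0 ≤ B := (norm_nonneg _).trans (hB 0 ⟨le_rfl, hT.le⟩)
  have hπ0 : v 0 T = 0 := by
    have := hvb 0 T ⟨hT.le, le_rfl⟩
    rw [abs_zero, zero_mul] at this
    exact abs_nonpos_iff.1 this
  rw [hasDerivAt_iff_isLittleO, Asymptotics.isLittleO_iff]
  intro ε hε
  -- on a thin strip the equation is `ε₁`-close to the linear one
  set K := Ex * B * T * Real.exp (I T) with hK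
  have hK0 : 0 ≤ K := by positivity
  set ε₁ := ε / (K + 1) with hε₁
  have hε₁pos : 0 < ε₁ := by positivity
  have hclose : ∀ t ∈ Icc 0 T, ∀ᶠ q in 𝓝 (t, (0 : ℝ)), |D q - p q.1| < ε₁ := by
    intro t ht
    have hcd : ContinuousAt D (t, 0) := hDc t ht 0 (by simpa using hδ₁.le)
    have hcp : ContinuousAt (fun q : ℝ × ℝ => p q.1) (t, 0) := by fun_prop
    refine (hcd.sub hcp).abs.eventually_lt continuousAt_const ?_
    simpa [hD0 t ht] using hε₁pos
  obtain ⟨δ₂, hδ₂, hδ₂c⟩ := exists_pos_forall_of_eventually hclose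
  set r := min δ₁ δ₂ with hr
  have hrpos : 0 < r := lt_min hδ₁ hδ₂
  have hlin : ∀ t ∈ Icc 0 T, ∀ y : ℝ, |y| ≤ r → |P (t, y) - p t * y| ≤ ε₁ * |y| := by
    intro t ht y hy
    have hball : ∀ z ∈ Icc (-r) r, |z| ≤ r := fun z hz => abs_le.2 hz
    have h1 := Convex.norm_image_sub_le_of_norm_hasDerivWithin_le
      (f := fun y => P (t, y) - p t * y) (f' := fun y => D (t, y) - p t * 1) (s := Icc (-r) r)
      (C := ε₁) (x := 0) (y := y)
      (fun z hz => ((hder t ht z ((hball z hz).trans (min_le_left _ _))).sub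
        ((hasDerivAt_id z).const_mul (p t))).hasDerivWithinAt)
      (fun z hz => by
        rw [mul_one]; exact (hδ₂c t ht z ((hball z hz).trans (min_le_right _ _))).le)
      (convex_Icc _ _) ⟨by linarith, hrpos.le⟩ (abs_le.1 hy)
    simpa [h0 t ht] using h1
  have hnhds : ∀ᶠ x in 𝓝 (0 : ℝ), |x| < r / Ex :=
    continuous_abs.continuousAt.eventually (gt_mem_nhds (by simpa using div_pos hrpos hExpos))
  filter_upwards [hnhds] with x hx
  have hvr := fun t ht => (hsmall x r hx t ht).le
  -- variation of constants
  have hw := norm_image_sub_le_of_norm_deriv_le_segment' (a := 0) (b := T)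
    (f := fun t => v x t * Real.exp (-I t)) (C := ε₁ * (|x| * Ex) * B)
    (f' := fun t => P (t, v x t) * Real.exp (-I t) + v x t * (Real.exp (-I t) * -p t))
    (fun t ht => (hvP x t ht ((hvr t ht).trans (min_le_left _ _))).mul
      (hId t).neg.exp.hasDerivWithinAt)
    (fun t ht => by
      have ht' := Ico_subset_Icc_self ht
      have h1 : P (t, v x t) * Real.exp (-I t) + v x t * (Real.exp (-I t) * -p t) =
        (P (t, v x t) - p t * v x t) * Real.exp (-I t) := by ring
      rw [h1, norm_mul]
      refine mul_le_mul ((hlin t ht' _ (hvr t ht')).trans ?_) (hB t ht') (norm_nonneg _)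
        (by positivity)
      exact mul_le_mul_of_nonneg_left (hvb x t ht') hε₁pos.le) T ⟨hT.le, le_rfl⟩
  have hI0 : I 0 = 0 := by simp [hIdef]
  simp only [hI0, neg_zero, Real.exp_zero, mul_one, hv0, sub_zero] at hw
  have hfin : v x T - v 0 T - (x - 0) • Real.exp (I T) =
      (v x T * Real.exp (-I T) - x) * Real.exp (I T) := by
    rw [hπ0, sub_mul, mul_assoc, ← Real.exp_add]; simp
  change ‖v x T - v 0 T - (x - 0) • Real.exp (I T)‖ ≤ ε * ‖x - 0‖
  rw [hfin, norm_mul, Real.norm_of_nonneg (Real.exp_pos _).le, sub_zero, Real.norm_eq_abs x]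
  calc ‖v x T * Real.exp (-I T) - x‖ * Real.exp (I T)
      ≤ ε₁ * (|x| * Ex) * B * T * Real.exp (I T) :=
        mul_le_mul_of_nonneg_right hw (Real.exp_pos _).le
    _ = ε₁ * K * |x| := by rw [hK]; ring
    _ ≤ ε * |x| := by
        refine mul_le_mul_of_nonneg_right ?_ (abs_nonneg x)
        rw [hε₁, div_mul_eq_mul_div, div_le_iff₀ (by positivity)]
        nlinarith

/-! ### Embedded annuli -/

/-- An immersion is locally injective. -/
lemma exists_injOn_of_linearIndependent {α : ℝ × ℝ → E3} (hα : ContDiff ℝ ∞ α) {q : ℝ × ℝ}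
    (h : LinearIndependent ℝ ![partialU α q, partialV α q]) : ∃ u ∈ 𝓝 q, InjOn α u := by
  have hstrict : HasStrictFDerivAt α (fderiv ℝ α q) q :=
    hα.contDiffAt.hasStrictFDerivAt (by simp)
  have hker : LinearMap.ker (fderiv ℝ α q : ℝ × ℝ →ₗ[ℝ] E3) = ⊥ := by
    rw [LinearMap.ker_eq_bot']
    intro w hw
    have hw' : w.1 • partialU α q + w.2 • partialV α q = 0 := by
      rw [partialU, partialV, ← map_smul, ← map_smul, ← map_add]
      simpa using hw
    have := LinearIndependent.pair_iff.1 h _ _ hw'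
    exact Prod.ext this.1 this.2
  obtain ⟨K, hK, hanti⟩ := LinearMap.exists_antilipschitzWith _ hker
  have hK' : (0 : ℝ) < K := hK
  have hev := hstrict.isLittleO.def (c := (2 * (K : ℝ))⁻¹) (by positivity)
  rw [nhds_prod_eq] at hev
  obtain ⟨u, hu, huv⟩ := mem_prod_self_iff.1 hev
  refine ⟨u, hu, fun x hx y hy hxy => ?_⟩
  have h1 := @huv (x, y) (mk_mem_prod hx hy)
  rw [mem_ofPred_eq] at h1
  have h2 : ‖x - y‖ ≤ K * ‖fderiv ℝ α q (x - y)‖ := by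
    rw [← dist_eq_norm, map_sub, ← dist_eq_norm]
    exact hanti.le_mul_dist x y
  rw [hxy, sub_self, zero_sub, norm_neg] at h1
  have h3 : ‖x - y‖ ≤ K * ((2 * (K : ℝ))⁻¹ * ‖x - y‖) :=
    h2.trans (mul_le_mul_of_nonneg_left h1 hK'.le)
  have h4 : (K : ℝ) * ((2 * (K : ℝ))⁻¹ * ‖x - y‖) = ‖x - y‖ / 2 := by
    field_simp
  rw [h4] at h3
  have h5 : ‖x - y‖ = 0 := by linarith [norm_nonneg (x - y)]
  exact sub_eq_zero.1 (norm_eq_zero.1 h5)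

/-- A periodic map which is injective on the closed curve `v = 0` and an immersion there induces an
embedding of all sufficiently thin annuli. -/
theorem exists_embedding_annulus {α : ℝ × ℝ → E3} {L : ℝ} (hL : 0 < L) (hα : ContDiff ℝ ∞ α)
    (hper : ∀ s v, α (s + L, v) = α (s, v)) (hinj : InjOn (fun s => α (s, 0)) (Ico 0 L))
    (himm : ∀ s, LinearIndependent ℝ ![partialU α (s, 0), partialV α (s, 0)]) :
    ∃ δ₀ > 0, ∀ δ : ℝ, 0 < δ → δ ≤ δ₀ → ∃ Φ : AddCircle L × Ioo (-δ) δ → E3, IsEmbedding Φ ∧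
      ∀ (s : ℝ) (v : Ioo (-δ) δ), Φ ((s : AddCircle L), v) = α (s, (v : ℝ)) := by
  have : Fact (0 < L) := ⟨hL⟩
  have hper' : ∀ v, Function.Periodic (fun s => α (s, v)) L := fun v s => hper s v
  set Φ : AddCircle L × ℝ → E3 := fun q => (hper' q.2).lift q.1 with hΦ
  have hΦα : ∀ s v : ℝ, Φ ((s : AddCircle L), v) = α (s, v) := fun s v => rfl
  set m : ℝ × ℝ → AddCircle L × ℝ := Prod.map (fun s : ℝ => (s : AddCircle L)) id with hm
  have hquot : IsOpenQuotientMap m :=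
    (QuotientAddGroup.isOpenQuotientMap_mk (N := AddSubgroup.zmultiples L)).prodMap .id
  have hΦc : Continuous Φ := by
    rw [← hquot.continuous_comp_iff]
    exact hα.continuous
  have hinjΦ : InjOn Φ (univ ×ˢ {(0 : ℝ)}) := by
    rintro ⟨x, v⟩ ⟨-, hv⟩ ⟨y, w⟩ ⟨-, hw⟩ hxy
    obtain rfl : v = 0 := hv
    obtain rfl : w = 0 := hw
    rw [← AddCircle.coe_equivIco (p := L) (a := 0) (y := x),
      ← AddCircle.coe_equivIco (p := L) (a := 0) (y := y), hΦα, hΦα] at hxy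
    have hIco : ∀ z : AddCircle L, (AddCircle.equivIco L 0 z : ℝ) ∈ Ico 0 L := fun z =>
      ⟨(AddCircle.equivIco L 0 z).2.1, by simpa using (AddCircle.equivIco L 0 z).2.2⟩
    rw [← AddCircle.coe_equivIco (p := L) (a := 0) (y := x),
      ← AddCircle.coe_equivIco (p := L) (a := 0) (y := y), hinj (hIco x) (hIco y) hxy]
  have hloc : ∀ x ∈ (univ : Set (AddCircle L)) ×ˢ {(0 : ℝ)}, ∃ u ∈ 𝓝 x, InjOn Φ u := by
    rintro ⟨x, v⟩ ⟨-, hv⟩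
    obtain rfl : v = 0 := hv
    obtain ⟨s, rfl⟩ := QuotientAddGroup.mk_surjective x
    obtain ⟨u, hu, hui⟩ := exists_injOn_of_linearIndependent hα (himm s)
    refine ⟨m '' u, hquot.isOpenMap.image_mem_nhds hu, ?_⟩
    rintro _ ⟨p, hp, rfl⟩ _ ⟨q, hq, rfl⟩ hpq
    rw [hui hp hq hpq]
  obtain ⟨t, ht, htinj⟩ := hinjΦ.exists_mem_nhdsSet (isCompact_univ.prod isCompact_singleton)
    (fun x _ => hΦc.continuousAt) hloc
  obtain ⟨u, w, -, hw, hu, hw0, huw⟩ := generalized_tube_lemma isCompact_univ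
    isCompact_singleton isOpen_interior (subset_interior_iff_mem_nhdsSet.2 ht)
  obtain ⟨δ₀, hδ₀, hball⟩ := Metric.nhds_basis_closedBall.mem_iff.1
    (hw.mem_nhds (hw0 (mem_singleton (0 : ℝ))))
  refine ⟨δ₀, hδ₀, fun δ hδ hle => ⟨fun q => Φ (q.1, (q.2 : ℝ)), ?_, fun s v => hΦα s v⟩⟩
  -- on the compact annulus `|v| ≤ δ` a continuous injection is an embedding
  set Ψ : AddCircle L × Icc (-δ) δ → E3 := fun q => Φ (q.1, (q.2 : ℝ)) with hΨ
  have hΨc : Continuous Ψ := hΦc.comp (by fun_prop)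
  have hmem : ∀ q : AddCircle L × Icc (-δ) δ, (q.1, (q.2 : ℝ)) ∈ t := by
    intro q
    refine interior_subset (huw ⟨hu (mem_univ _), hball ?_⟩)
    simpa [Real.dist_eq] using (abs_le.2 q.2.2).trans hle
  have hΨi : Function.Injective Ψ := by
    rintro ⟨x, v⟩ ⟨y, w⟩ hxy
    have := htinj (hmem (x, v)) (hmem (y, w)) hxy
    simp only [Prod.mk.injEq, Subtype.val_inj] at this
    exact Prod.ext this.1 this.2
  have hΨe : IsEmbedding Ψ := (hΨc.isClosedEmbedding hΨi).isEmbedding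
  exact hΨe.comp (IsEmbedding.id.prodMap (IsEmbedding.inclusion Ioo_subset_Icc_self))

/-! ### Ribbons with a hyperbolic principal cycle -/

/-- A closed curve with a parallel frame is a hyperbolic principal cycle of the ribbon of
second-order coefficient `A` if `A + κ₂ > 0` and the exponent `∫ A' / (A + κ₂)` does not vanish. -/
theorem IsParallelFrame.isGermWithHyperbolicCycle {c T U V : ℝ → E3} {κ₁ κ₂ A : ℝ → ℝ} {L : ℝ}
    (hF : IsParallelFrame c T U V κ₁ κ₂) (hA : ContDiff ℝ ∞ A) (hL : 0 < L)
    (hinj : InjOn c (Ico 0 L)) (hper : ∀ s v, ribbon c U V A (s + L, v) = ribbon c U V A (s, v))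
    (hpos : ∀ s, 0 < A s + κ₂ s) (hexp : ∫ s in (0 : ℝ)..L, deriv A s / (A s + κ₂ s) ≠ 0) :
    IsGermWithHyperbolicCycle c L (ribbon c U V A) := by
  obtain ⟨E, F, G, e, f, g, hf⟩ := hF.exists_hasForms hA
  set α := ribbon c U V A with hαdef
  have hα : ContDiff ℝ ∞ α := hF.contDiff_ribbon hA
  have hα0 : ∀ s, α (s, 0) = c s := fun s => by simp [hαdef, ribbon]
  set P := principalSlope E F G e f g with hP
  have hevent : ∀ s ∈ Icc 0 L, ∀ᶠ p in 𝓝 (s, (0 : ℝ)),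
      LinearIndependent ℝ ![partialU α p, partialV α p] ∧ ¬ IsUmbilic α p ∧
        PrincipalEquation α p (1, P p) ∧ MinimalDirection α p (1, P p) := by
    intro s _
    filter_upwards [hf.eventually_pos (hpos s)] with p hp
    exact ⟨hf.linearIndependent hp.2.1,
      hf.principal_direction hp.1 hp.2.1 hp.2.2.1 hp.2.2.2⟩
  obtain ⟨δ₁, hδ₁, h1⟩ := exists_pos_forall_of_eventually hevent
  obtain ⟨δ₂, hδ₂, h2⟩ := exists_embedding_annulus hL hα hper
    (by simpa only [hα0] using hinj)
    (fun s => hf.linearIndependent (hf.eventually_pos (hpos s)).self_of_nhds.2.1)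
  have hδ : 0 < min δ₁ δ₂ := lt_min hδ₁ hδ₂
  refine ⟨min δ₁ δ₂, hδ, ⟨hα.contDiffOn, ?_, h2 _ hδ (min_le_right _ _)⟩, hα0, Or.inl ⟨?_, ?_⟩⟩
  · rintro ⟨s, v⟩ ⟨-, hv⟩
    have hfd : Function.Periodic (fun s => fderiv ℝ α (s, v)) L := by
      intro s
      have h3 : (fun p : ℝ × ℝ => α (p + (L, 0))) = α := by
        funext ⟨s, v⟩
        simpa using hper s v
      have h4 := fderiv_comp_add_right (𝕜 := ℝ) (f := α) (x := (s, v)) ((L, 0) : ℝ × ℝ)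
      rw [h3] at h4
      simpa using h4.symm
    obtain ⟨y, hy, hys⟩ := hfd.exists_mem_Ico₀ hL s
    have h5 := (h1 y (Ico_subset_Icc_self hy) v
      ((abs_lt.2 hv).le.trans (min_le_left _ _))).1
    simp only [partialU, partialV] at h5 ⊢
    change fderiv ℝ α (s, v) = fderiv ℝ α (y, v) at hys
    rwa [hys]
  · intro s _
    have hp := (hf.eventually_pos (hpos s)).self_of_nhds
    obtain ⟨hu, hpe, hmin⟩ := hf.principal_direction hp.1 hp.2.1 hp.2.2.1 hp.2.2.2
    rw [hf.principalSlope_zero] at hpe hmin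
    refine ⟨hu, (1, 0), by simp, ?_, hpe, hmin⟩
    exact ((hasDerivAt_id s).prodMk (hasDerivAt_const s 0)).hasDerivWithinAt
  · have hA1 := (contDiff_infty_iff_deriv.1 hA).2
    have hκ₂ := hF.smooth_κ₂
    have hcont : Continuous fun s => -(deriv A s / (A s + κ₂ s)) :=
      (hA1.continuous.div (hA.continuous.add hκ₂.continuous) fun s => (hpos s).ne').neg
    obtain ⟨π, hπ, η, hη, hsol⟩ := exists_transitionMap (P := P) hL hδ
      (fun t _ => by
        have hp := (hf.eventually_pos (hpos t)).self_of_nhds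
        exact (hf.contDiffAt_principalSlope hp.2.2.1 hp.2.2.2).of_le (by simp))
      (fun t _ => hf.principalSlope_zero t) hcont
      (fun t _ => hf.hasDerivAt_principalSlope (hpos t))
    refine ⟨π, _, ⟨η, hη, fun x hx => ?_⟩, hπ, ?_⟩
    · obtain ⟨v, hv0, hvL, hv⟩ := hsol x hx
      refine ⟨L, fun t => (t, v t), hL, fun t ht => ?_, fun t ht => (hv t ht).1, by simp [hv0],
        by simp [hvL], fun t ht => ht⟩
      obtain ⟨-, hu, hpe, hmin⟩ := h1 t ht (v t) ((hv t ht).1.le.trans (min_le_left _ _))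
      exact ⟨hu, (1, P (t, v t)), by simp, (hasDerivAt_id t).hasDerivWithinAt.prodMk (hv t ht).2,
        hpe, hmin⟩
    · rw [Ne, Real.exp_eq_one_iff, intervalIntegral.integral_neg, neg_eq_zero]
      exact hexp

/-! ### The characteristic exponent of the explicit surfaces -/

namespace IsClosedFrenetCurve

variable {c : ℝ → E3} {L : ℝ} {θ : ℝ → ℝ}

lemma angle_add_length (hc : IsClosedFrenetCurve c L) (hθ : ∀ s, HasDerivAt θ (-torsion c s) s)
    {m : ℤ} (htot : (∫ s in (0 : ℝ)..L, torsion c s) = 2 * m * Real.pi) (s : ℝ) :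
    θ (s + L) = θ s - m * (2 * Real.pi) := by
  have hint : ∫ x in s..(s + L), -torsion c x = θ (s + L) - θ s :=
    intervalIntegral.integral_eq_sub_of_hasDerivAt (fun x _ => hθ x)
      (hc.contDiff_torsion.continuous.neg.intervalIntegrable _ _)
  rw [intervalIntegral.integral_neg, hc.periodic_torsion.intervalIntegral_add_eq s 0, zero_add,
    htot] at hint
  linarith

lemma periodic_sin (hc : IsClosedFrenetCurve c L) (hθ : ∀ s, HasDerivAt θ (-torsion c s) s)
    {m : ℤ} (htot : (∫ s in (0 : ℝ)..L, torsion c s) = 2 * m * Real.pi) :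
    Function.Periodic (fun s => Real.sin (θ s)) L := fun s => by
  simp only [hc.angle_add_length hθ htot s, Real.sin_sub_int_mul_two_pi]

lemma periodic_cos (hc : IsClosedFrenetCurve c L) (hθ : ∀ s, HasDerivAt θ (-torsion c s) s)
    {m : ℤ} (htot : (∫ s in (0 : ℝ)..L, torsion c s) = 2 * m * Real.pi) :
    Function.Periodic (fun s => Real.cos (θ s)) L := fun s => by
  simp only [hc.angle_add_length hθ htot s, Real.cos_sub_int_mul_two_pi]

lemma periodic_curvature_mul_sin (hc : IsClosedFrenetCurve c L)
    (hθ : ∀ s, HasDerivAt θ (-torsion c s) s) {m : ℤ}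
    (htot : (∫ s in (0 : ℝ)..L, torsion c s) = 2 * m * Real.pi) :
    Function.Periodic (fun s => curvature c s * Real.sin (θ s)) L :=
  hc.periodic_curvature.mul (hc.periodic_sin hθ htot)

lemma periodic_deriv_curvature_mul_sin (hc : IsClosedFrenetCurve c L)
    (hθ : ∀ s, HasDerivAt θ (-torsion c s) s) {m : ℤ}
    (htot : (∫ s in (0 : ℝ)..L, torsion c s) = 2 * m * Real.pi) :
    Function.Periodic (deriv fun s => curvature c s * Real.sin (θ s)) L := by
  intro s
  rw [← deriv_comp_add_const,
    show (fun x => curvature c (x + L) * Real.sin (θ (x + L))) =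
      fun x => curvature c x * Real.sin (θ x) from
      funext (hc.periodic_curvature_mul_sin hθ htot)]

lemma contDiff_coeffA (hc : IsClosedFrenetCurve c L) (hθ : ∀ s, HasDerivAt θ (-torsion c s) s)
    (ε : ℝ) : ContDiff ℝ ∞ (coeffA c θ ε) := by
  have hκ := (hc.isParallelFrame hθ).smooth_κ₂
  have hκ' := (contDiff_infty_iff_deriv.1 hκ).2
  have h : coeffA c θ ε = fun s => curvature c s - curvature c s * Real.sin (θ s) +
      ε * deriv (fun x => curvature c x * Real.sin (θ x)) s := by
    funext s; rw [coeffA]; ring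
  rw [h]
  exact (hc.contDiff_curvature.sub hκ).add (contDiff_const.mul hκ')

lemma coeffA_add (ε s : ℝ) : coeffA c θ ε s + curvature c s * Real.sin (θ s) =
    curvature c s + ε * deriv (fun x => curvature c x * Real.sin (θ x)) s := by
  rw [coeffA]; ring

/-- The explicit surface defines a germ as wanted if `A_ε + k sin θ = k + ε (k sin θ)'` is positive and its
characteristic exponent does not vanish. -/
lemma isGermWithHyperbolicCycle (hc : IsClosedFrenetCurve c L)
    (hθ : ∀ s, HasDerivAt θ (-torsion c s) s) {m : ℤ}
    (htot : (∫ s in (0 : ℝ)..L, torsion c s) = 2 * m * Real.pi) {ε : ℝ}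
    (hpos : ∀ s, 0 < curvature c s + ε * deriv (fun x => curvature c x * Real.sin (θ x)) s)
    (hexp : charExponent c L θ (coeffA c θ ε) ≠ 0) :
    IsGermWithHyperbolicCycle c L (stripSurface c θ (coeffA c θ ε)) := by
  refine (hc.isParallelFrame hθ).isGermWithHyperbolicCycle (hc.contDiff_coeffA hθ ε) hc.length_pos
    hc.simple (fun s v => ?_) (fun s => by rw [coeffA_add]; exact hpos s) hexp
  have h1 : Real.sin (θ (s + L)) = Real.sin (θ s) := hc.periodic_sin hθ htot s
  have h2 : Real.cos (θ (s + L)) = Real.cos (θ s) := hc.periodic_cos hθ htot s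
  simp only [ribbon, coeffA, hc.periodic s, hc.periodic_normal s, hc.periodic_binormal s,
    hc.periodic_curvature s, h1, h2, hc.periodic_deriv_curvature_mul_sin hθ htot s]

/-- Since `A_ε + κ = k + ε κ'` for `κ = k sin θ`, the exponent is `∫ (log (k + ε κ'))'`, which
vanishes by periodicity, minus `∫ κ' / (k + ε κ')`. -/
lemma charExponent_coeffA (hc : IsClosedFrenetCurve c L)
    (hθ : ∀ s, HasDerivAt θ (-torsion c s) s) {m : ℤ}
    (htot : (∫ s in (0 : ℝ)..L, torsion c s) = 2 * m * Real.pi) {ε : ℝ}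
    (hpos : ∀ s, 0 < curvature c s + ε * deriv (fun x => curvature c x * Real.sin (θ x)) s) :
    charExponent c L θ (coeffA c θ ε) =
      -∫ s in (0 : ℝ)..L, deriv (fun x => curvature c x * Real.sin (θ x)) s /
        (curvature c s + ε * deriv (fun x => curvature c x * Real.sin (θ x)) s) := by
  have hA := hc.contDiff_coeffA hθ ε
  have hκ := (hc.isParallelFrame hθ).smooth_κ₂
  have hκ'p := hc.periodic_deriv_curvature_mul_sin hθ htot
  have hk := hc.contDiff_curvature
  have hcoe := fun s => coeffA_add (c := c) (θ := θ) ε s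
  set κ : ℝ → ℝ := fun x => curvature c x * Real.sin (θ x) with hκdef
  have hκ' := (contDiff_infty_iff_deriv.1 hκ).2
  set h : ℝ → ℝ := fun s => curvature c s + ε * deriv κ s with hh
  have hhs : ContDiff ℝ ∞ h := hk.add (contDiff_const.mul hκ')
  have hh' := (contDiff_infty_iff_deriv.1 hhs).2
  have hAd : ∀ s, deriv (coeffA c θ ε) s = deriv h s - deriv κ s := by
    intro s
    have : coeffA c θ ε = fun s => h s - κ s := by
      funext s; rw [eq_sub_iff_add_eq]; exact hcoe s
    rw [this]
    exact deriv_fun_sub (hhs.differentiable (by simp) s) (hκ.differentiable (by simp) s)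
  have hint : ∫ s in (0 : ℝ)..L, deriv h s / h s = Real.log (h L) - Real.log (h 0) :=
    intervalIntegral.integral_eq_sub_of_hasDerivAt
      (fun s _ => ((hhs.differentiable (by simp) s).hasDerivAt).log (hpos s).ne')
      ((hh'.continuous.div hhs.continuous fun s => (hpos s).ne').intervalIntegrable _ _)
  have hper : h L = h 0 := by
    have h1 := hc.periodic_curvature 0
    have h2 := hκ'p 0
    rw [zero_add] at h1 h2
    simp only [hh, h1, h2]
  rw [hper, sub_self] at hint
  calc charExponent c L θ (coeffA c θ ε)
      = ∫ s in (0 : ℝ)..L, (deriv h s / h s - deriv κ s / h s) := by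
        refine intervalIntegral.integral_congr fun s _ => ?_
        change deriv (coeffA c θ ε) s / (coeffA c θ ε s + κ s) = _
        rw [hAd, show coeffA c θ ε s + κ s = h s from hcoe s, sub_div]
    _ = _ := by
        rw [intervalIntegral.integral_sub, hint, zero_sub]
        · exact (hh'.continuous.div hhs.continuous fun s => (hpos s).ne').intervalIntegrable _ _
        · exact (hκ'.continuous.div hhs.continuous fun s => (hpos s).ne').intervalIntegrable _ _

/-- If the exponent vanishes at `ε = 0`, it equals `ε ∫ κ'² / (k (k + ε κ'))` with `κ = k sin θ`. -/
lemma charExponent_ne_zero (hc : IsClosedFrenetCurve c L)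
    (hθ : ∀ s, HasDerivAt θ (-torsion c s) s) {m : ℤ}
    (htot : (∫ s in (0 : ℝ)..L, torsion c s) = 2 * m * Real.pi)
    (hne : ∃ s, deriv (fun x => curvature c x * Real.sin (θ x)) s ≠ 0)
    (hzero : charExponent c L θ (coeffA c θ 0) = 0) {ε : ℝ} (hε : ε ≠ 0)
    (hpos : ∀ s, 0 < curvature c s + ε * deriv (fun x => curvature c x * Real.sin (θ x)) s) :
    charExponent c L θ (coeffA c θ ε) ≠ 0 := by
  have hκ := (hc.isParallelFrame hθ).smooth_κ₂
  have hκ'p := hc.periodic_deriv_curvature_mul_sin hθ htot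
  rw [hc.charExponent_coeffA hθ htot (by simpa using hc.curvature_pos)] at hzero
  rw [hc.charExponent_coeffA hθ htot hpos]
  set κ : ℝ → ℝ := fun x => curvature c x * Real.sin (θ x) with hκdef
  have hκ' := (contDiff_infty_iff_deriv.1 hκ).2.continuous
  have hk := hc.contDiff_curvature.continuous
  have hk0 := hc.curvature_pos
  simp only [zero_mul, add_zero] at hzero
  have hc1 : Continuous fun s => deriv κ s / curvature c s := hκ'.div hk fun s => (hk0 s).ne'
  have hch : Continuous fun s => curvature c s + ε * deriv κ s := by fun_prop
  have hc2 : Continuous fun s => deriv κ s / (curvature c s + ε * deriv κ s) :=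
    hκ'.div hch fun s => (hpos s).ne'
  have hc3 : Continuous fun s =>
      deriv κ s ^ 2 / (curvature c s * (curvature c s + ε * deriv κ s)) :=
    (hκ'.pow 2).div (hk.mul hch) fun s => (mul_pos (hk0 s) (hpos s)).ne'
  have hdiff : ∫ s in (0 : ℝ)..L, (deriv κ s / curvature c s -
      deriv κ s / (curvature c s + ε * deriv κ s)) =
      ε * ∫ s in (0 : ℝ)..L, deriv κ s ^ 2 / (curvature c s * (curvature c s + ε * deriv κ s)) := by
    rw [← intervalIntegral.integral_const_mul]
    refine intervalIntegral.integral_congr fun s _ => ?_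
    have h1 := (hk0 s).ne'
    have h2 := (hpos s).ne'
    change deriv κ s / curvature c s - deriv κ s / (curvature c s + ε * deriv κ s) =
      ε * (deriv κ s ^ 2 / (curvature c s * (curvature c s + ε * deriv κ s)))
    rw [div_sub_div _ _ h1 h2, ← mul_div_assoc]
    congr 1
    ring
  rw [intervalIntegral.integral_sub (hc1.intervalIntegrable _ _) (hc2.intervalIntegrable _ _),
    neg_eq_zero.1 hzero, zero_sub] at hdiff
  rw [hdiff]
  refine mul_ne_zero hε (intervalIntegral.integral_pos hc.length_pos hc3.continuousOn
    (fun s _ => by have := hk0 s; have := hpos s; positivity) ?_).ne'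
  obtain ⟨s₀, hs₀⟩ := hne
  obtain ⟨y, hy, hys⟩ := hκ'p.exists_mem_Ico₀ hc.length_pos s₀
  refine ⟨y, Ico_subset_Icc_self hy, ?_⟩
  rw [hys] at hs₀
  have := hk0 y
  have := hpos y
  positivity

/-- For small `ε` the explicit surface has no umbilic point on the curve. -/
lemma eventually_curvature_add_pos (hc : IsClosedFrenetCurve c L)
    (hθ : ∀ s, HasDerivAt θ (-torsion c s) s) {m : ℤ}
    (htot : (∫ s in (0 : ℝ)..L, torsion c s) = 2 * m * Real.pi) :
    ∀ᶠ ε in 𝓝 (0 : ℝ), ∀ s,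
      0 < curvature c s + ε * deriv (fun x => curvature c x * Real.sin (θ x)) s := by
  have hκ := (hc.isParallelFrame hθ).smooth_κ₂
  have hκ'p := hc.periodic_deriv_curvature_mul_sin hθ htot
  set κ : ℝ → ℝ := fun x => curvature c x * Real.sin (θ x) with hκdef
  have hκ' := (contDiff_infty_iff_deriv.1 hκ).2.continuous
  have hk := hc.contDiff_curvature.continuous
  have hcont : Continuous fun q : ℝ × ℝ => curvature c q.1 + q.2 * deriv κ q.1 := by fun_prop
  obtain ⟨δ, hδ, h⟩ := exists_pos_forall_of_eventually (T := L)
    (C := fun q => 0 < curvature c q.1 + q.2 * deriv κ q.1)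
    (fun t _ => hcont.continuousAt.eventually (lt_mem_nhds (by simpa using hc.curvature_pos t)))
  have hnhds : ∀ᶠ ε in 𝓝 (0 : ℝ), |ε| < δ :=
    continuous_abs.continuousAt.eventually (gt_mem_nhds (by simpa using hδ))
  filter_upwards [hnhds] with ε hε s
  have hp : Function.Periodic (fun s => curvature c s + ε * deriv κ s) L := fun s => by
    simp only [hc.periodic_curvature s, hκ'p s]
  obtain ⟨y, hy, hys⟩ := hp.exists_mem_Ico₀ hc.length_pos s
  have h1 := h y (Ico_subset_Icc_self hy) ε hε.le
  change curvature c s + ε * deriv κ s = curvature c y + ε * deriv κ y at hys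
  rw [hys]
  exact h1

/-- If the torsion is not identically zero, the angle `θ` can be normalized so that `k sin θ` is not
constant: otherwise both `k sin θ` and `k cos θ`, hence the angle, would be constant. -/
lemma exists_angle (hc : IsClosedFrenetCurve c L) (hτ : ∃ s, torsion c s ≠ 0) :
    ∃ θ : ℝ → ℝ, (∀ s, HasDerivAt θ (-torsion c s) s) ∧
      ∃ s, deriv (fun x => curvature c x * Real.sin (θ x)) s ≠ 0 := by
  have hτc := hc.contDiff_torsion.continuous
  have hθ : ∀ s, HasDerivAt (fun s => -∫ x in (0 : ℝ)..s, torsion c x) (-torsion c s) s := fun s =>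
    (intervalIntegral.integral_hasDerivAt_right (hτc.intervalIntegrable _ _)
      hτc.stronglyMeasurable.stronglyMeasurableAtFilter hτc.continuousAt).neg
  set θ : ℝ → ℝ := fun s => -∫ x in (0 : ℝ)..s, torsion c x
  obtain ⟨s, hs⟩ := hτ
  have hk := (hc.contDiff_curvature.differentiable (by simp) s).hasDerivAt
  by_cases h : deriv (fun x => curvature c x * Real.sin (θ x)) s = 0
  · refine ⟨fun s => θ s + Real.pi / 2, fun s => (hθ s).add_const _, s, fun h' => hs ?_⟩
    simp only [Real.sin_add_pi_div_two] at h'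
    have e1 := (hk.mul (hθ s).sin).deriv.symm.trans h
    have e2 := (hk.mul (hθ s).cos).deriv.symm.trans h'
    have e3 : curvature c s * torsion c s = 0 := by
      have := Real.sin_sq_add_cos_sq (θ s)
      linear_combination (-Real.cos (θ s)) * e1 + Real.sin (θ s) * e2 -
        curvature c s * torsion c s * this
    exact (mul_eq_zero.1 e3).resolve_left (hc.curvature_pos s).ne'
  · exact ⟨θ, hθ, s, h⟩

end IsClosedFrenetCurve

end

theorem theorem3p3 (c : ℝ → E3) (L : ℝ) (hc : IsClosedFrenetCurve c L)
    (hτ : ∃ s, torsion c s ≠ 0)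
    (m : ℤ) (htot : (∫ s in (0 : ℝ)..L, torsion c s) = 2 * m * Real.pi) :
    (∃ α : ℝ × ℝ → E3, IsGermWithHyperbolicCycle c L α) ∧
    ∃ θ : ℝ → ℝ, (∀ s, HasDerivAt θ (-torsion c s) s) ∧
      (charExponent c L θ (coeffA c θ 0) ≠ 0 →
        IsGermWithHyperbolicCycle c L (stripSurface c θ (coeffA c θ 0))) ∧
      (charExponent c L θ (coeffA c θ 0) = 0 →
        ∀ᶠ ε in 𝓝[≠] (0 : ℝ), charExponent c L θ (coeffA c θ ε) ≠ 0 ∧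
          IsGermWithHyperbolicCycle c L (stripSurface c θ (coeffA c θ ε))) := by
  obtain ⟨θ, hθ, hne⟩ := hc.exists_angle hτ
  have h1 : charExponent c L θ (coeffA c θ 0) ≠ 0 →
      IsGermWithHyperbolicCycle c L (stripSurface c θ (coeffA c θ 0)) := fun h =>
    hc.isGermWithHyperbolicCycle hθ htot (by simpa using hc.curvature_pos) h
  have h2 : charExponent c L θ (coeffA c θ 0) = 0 →
      ∀ᶠ ε in 𝓝[≠] (0 : ℝ), charExponent c L θ (coeffA c θ ε) ≠ 0 ∧
        IsGermWithHyperbolicCycle c L (stripSurface c θ (coeffA c θ ε)) := by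
    intro hzero
    filter_upwards [self_mem_nhdsWithin,
      nhdsWithin_le_nhds (hc.eventually_curvature_add_pos hθ htot)] with ε hε hpos
    have hexp := hc.charExponent_ne_zero hθ htot hne hzero hε hpos
    exact ⟨hexp, hc.isGermWithHyperbolicCycle hθ htot hpos hexp⟩
  refine ⟨?_, θ, hθ, h1, h2⟩
  by_cases h : charExponent c L θ (coeffA c θ 0) = 0
  · obtain ⟨ε, hε⟩ := (h2 h).exists
    exact ⟨_, hε.2⟩
  · exact ⟨_, h1 h⟩
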